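/- **Setting.** Let $\mathcal G=(\mathcal V,\mathcal E,C)$ be a finite directed multigraph (parallel links allowed, no self-loops). A link $e\in\mathcal E$ has tail $\sigma_e$, head $\tau_e$ and capacity $C_e\in(0,\infty)$. Put $\mathcal E_v^+=\{e:\sigma_e=v\}$. Let $\mathcal D=\{v:\mathcal E_v^+=\emptyset\}$ be the set of destinations, let $\lambda\in\mathbb R_+^{\mathcal V\setminus\mathcal D}$ be a vector of inflows, and let $\mathcal O=\{v:\lambda_v>0\}$ be the set of origins. The augmented network has one more node $w$, a link $e_v=(w,v)$ for each $v\in\mathcal O$, and a link $e^d=(d,w)$ for each $d\in\mathcal D$. Assume that $\mathcal D\neq\emptyset$ and that the augmented network is strongly connected. All buffer capacities are $+\infty$. A link with density $+\infty$ is called congested. For $i\in\mathcal E\cup\{e_v:v\in\mathcal O\}$ let $\mathcal E_i^+$ be the set of links of the augmented network that leave the head of $i$. If $i$ points into a destination, $\mathcal E_i^+$ consists of the single link to $w$. Let $\mathcal E_i$ be the set of links of $\mathcal E$ that lie in $\mathcal E_i^+\cup\{i\}$. Let $\mathcal R_i^\bullet$ be $[0,\infty]^{\mathcal E_i}$ if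 $i$ points into a destination, and $[0,\infty]^{\mathcal E_i}\setminus\{(\infty,\dots,\infty)\}$ otherwise. **Policies.** A *distributed routing policy* is a family of maps $f^i=(f_{i\to j})_{j\in\mathcal E_i^+}:\mathcal R_i^\bullet\to\mathbb R_+^{\mathcal E_i^+}$ that are continuous on $\mathcal R_i^\bullet$ and Lipschitz on $[0,\infty)^{\mathcal E_i}$. With $f_i^{\rm out}=\sum_{j\in\mathcal E_i^+}f_{i\to j}$, it satisfies: - $f^{\rm out}_{e_v}\equiv\lambda_v$ for every $v\in\mathcal O$; - for $e\in\mathcal E$: $f_e^{\rm out}\le C_e$, $f_e^{\rm out}=0$ where $\rho_e=0$, and $f_e^{\rm out}=C_e$ where $\rho_e=\infty$; - if $i$ does not point into a destination: $f_{i\to k}=0$ where $\rho_k=\infty$, for every $k\in\mathcal E_i^+$. The policy is *monotone* if, for all $i$ and almost every finite local density vector, $\partial f_{i\to j}/\partial\rho_k\ge0$ for $j\in\mathcal E_i^+$, $k\in\mathcal E_i\setminus\{j\}$, and $\partial f_i^{\rm out}/\partial\rho_k\le0$ for $k\in\mathcal E_i\cap\mathcal E_i^+$. It is *strongly monotone*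 if, in addition, both monotonicities are strict on $\mathcal R_i^\bullet$ wherever the quantity is not forced to be constant by the properties above, that is: - $f_{i\to j}$ is strictly increasing in each $\rho_k\in[0,\infty]$, $k\in\mathcal E_i\setminus\{j\}$, whatever the fixed values of the other local densities, provided $\rho_j<\infty$ and, if $i\in\mathcal E$ and $k\ne i$, $\rho_i>0$; - for $e\in\mathcal E$ and $0<\rho_e<\infty$, $f_e^{\rm out}$ is strictly decreasing in each $\rho_k\in[0,\infty]$, $k\in\mathcal E_e^+\cap\mathcal E$, whatever the fixed values of the other local densities. **Dynamics.** $\dot\rho_e=f_e^{\rm in}(\rho)-f_e^{\rm out}(\rho)$ for $e\in\mathcal E$, where $f_e^{\rm in}$ is the sum of $f_{i\to e}$ over all links $i$ of $\mathcal E\cup\{e_v:v\in\mathcal O\}$ pointing into $\sigma_e$. For $\rho^\circ\in[0,\infty)^{\mathcal E}$ let $\kappa(\rho^\circ)$ be the maximal time up to which the solution with $\rho(0)=\rho^\circ$ exists in $[0,\infty)^{\mathcal E}$. **Cuts.** A cut is a nonempty $\mathcal U\subseteq\mathcal V\setminus\mathcal D$. For $\mathcal U\subseteq\mathcal V$ put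 $\mathcal E^+_{\mathcal U}=\{e:\sigma_e\in\mathcal U\}$, $\partial^+_{\mathcal U}=\{e:\sigma_e\in\mathcal U,\tau_e\notin\mathcal U\}$, $\partial^-_{\mathcal U}=\{e:\sigma_e\notin\mathcal U,\tau_e\in\mathcal U\}$, $\lambda_{\mathcal U}=\sum_{v\in\mathcal U}\lambda_v$ and $C_{\mathcal U}=\sum_{e\in\partial^+_{\mathcal U}}C_e$. **Proposition.** Let $f$ be a strongly monotone distributed routing policy, and assume that $\max_{\mathcal U}(\lambda_{\mathcal U}-C_{\mathcal U})\ge0$, the maximum being over all cuts. Let $\mathcal U^*$ be the union of all cuts attaining the maximum. Then there are $\rho_e^*\in[0,\infty)$, $e\in\mathcal E\setminus(\mathcal E^+_{\mathcal U^*}\cup\partial^-_{\mathcal U^*})$, such that for every $\rho^\circ\in[0,\infty)^{\mathcal E}$ the dynamics has a unique solution $\rho(t)$ with $\rho(0)=\rho^\circ$, $\kappa(\rho^\circ)=+\infty$, and $$\lim_{t\to\infty}\rho_e(t)=+\infty\quad\forall e\in\mathcal E^+_{\mathcal U^*},\qquad \lim_{t\to\infty}\frac1t\sum_{e\in\mathcal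 E^+_{\mathcal U^*}}\rho_e(t)=\lambda_{\mathcal U^*}-C_{\mathcal U^*},$$ $$\lim_{t\to\infty}\rho_e(t)=\rho^*_e\quad\forall e\in\mathcal E\setminus(\mathcal E^+_{\mathcal U^*}\cup\partial^-_{\mathcal U^*}).$$ -/

import Mathlib

open Filter Topology MeasureTheory
open scoped ENNReal NNReal

noncomputable section

/-- A finite directed multigraph without self-loops, with node set `V`, link set `E`, positive link
capacities, and a nonnegative vector of external inflows supported on the non-destination nodes
(a destination is a node without outgoing links). -/
structure FlowNetwork (V E : Type*) where
  /-- tail node of a link -/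
  src : E → V
  /-- head node of a link -/
  tgt : E → V
  no_self_loop : ∀ e, src e ≠ tgt e
  /-- flow capacity of a link -/
  cap : E → ℝ
  cap_pos : ∀ e, 0 < cap e
  /-- external inflow at a node -/
  inflow : V → ℝ
  inflow_nonneg : ∀ v, 0 ≤ inflow v
  inflow_destination : ∀ v, (∀ e, src e ≠ v) → inflow v = 0

namespace FlowNetwork

variable {V E : Type*}

/-- Destination nodes: nodes without outgoing links. -/
def IsDestination (N : FlowNetwork V E) (v : V) : Prop := ∀ e, N.src e ≠ v

/-- Origin nodes: nodes with positive external inflow. -/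
def IsOrigin (N : FlowNetwork V E) (v : V) : Prop := 0 < N.inflow v

/-- Adjacency in the augmented network, which has one more node `none` (the external world), a link
from it to every origin, and a link from every destination to it. -/
def AugAdj (N : FlowNetwork V E) : Option V → Option V → Prop
  | some u, some v => ∃ e, N.src e = u ∧ N.tgt e = v
  | none, some v => N.IsOrigin v
  | some u, none => N.IsDestination u
  | none, none => False

/-- There is a destination, and the augmented network is strongly connected. -/
def IsConnected (N : FlowNetwork V E) : Prop :=
  (∃ d, N.IsDestination d) ∧ ∀ a b : Option V, Relation.ReflTransGen N.AugAdj a b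

/-- The links from which flow is routed: the links of the network and one link from the external
world to each origin. -/
abbrev InLink (N : FlowNetwork V E) : Type _ := E ⊕ {v : V // N.IsOrigin v}

/-- The links to which flow is routed: the links of the network and one link from each
destination to the external world. -/
abbrev OutLink (N : FlowNetwork V E) : Type _ := E ⊕ {v : V // N.IsDestination v}

/-- The node of the network into which a routing link points. -/
def head (N : FlowNetwork V E) : N.InLink → V
  | .inl e => N.tgt e
  | .inr o => o.1

/-- The node of the network out of which a receiving link comes. -/
def tail (N : FlowNetwork V E) : N.OutLink → V
  | .inl e => N.src e
  | .inr d => d.1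

variable [Fintype V] [Fintype E]

instance (N : FlowNetwork V E) : Fintype {v : V // N.IsOrigin v} := Fintype.ofFinite _

instance (N : FlowNetwork V E) : Fintype {v : V // N.IsDestination v} := Fintype.ofFinite _

open Classical in
/-- The links whose densities are visible to the routing link `i`: the links of the network that
are downstream of `i`, and `i` itself if it is a link of the network. -/
def localLinks (N : FlowNetwork V E) (i : N.InLink) : Finset E :=
  Finset.univ.filter fun k => N.src k = N.head i ∨ Sum.inl k = i

/-- Local density vectors with values in `[0,∞]`; the value `∞` means congested. -/
abbrev LocalDensity (N : FlowNetwork V E) (i : N.InLink) : Type _ := N.localLinks i → ℝ≥0∞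

/-- The local density vectors at which the routing out of `i` is defined: all of them if `i` points
into a destination, and otherwise those in which not all visible links are congested. -/
def localDomain (N : FlowNetwork V E) (i : N.InLink) : Set (N.LocalDensity i) :=
  {x | N.IsDestination (N.head i) ∨ ∃ k, x k ≠ ∞}

/-- A distributed routing policy, for infinite buffer capacities: `flow i x j` is the flow from
`i` to `j` when the local density vector at `i` is `x`. -/
structure RoutingPolicy (N : FlowNetwork V E) where
  flow : (i : N.InLink) → N.LocalDensity i → N.OutLink → ℝ
  flow_eq_zero : ∀ i, ∀ x ∈ N.localDomain i, ∀ j, N.tail j ≠ N.head i → flow i x j = 0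
  flow_nonneg : ∀ i, ∀ x ∈ N.localDomain i, ∀ j, 0 ≤ flow i x j
  continuousOn : ∀ i j, ContinuousOn (fun x => flow i x j) (N.localDomain i)
  lipschitz : ∀ i j, ∃ K : ℝ≥0,
    LipschitzWith K fun x : N.localLinks i → ℝ≥0 => flow i (fun k => (x k : ℝ≥0∞)) j
  outflow_le : ∀ e : E, ∀ x ∈ N.localDomain (.inl e),
    ∑ j, flow (.inl e) x j ≤ N.cap e
  outflow_origin : ∀ o : {v : V // N.IsOrigin v}, ∀ x ∈ N.localDomain (.inr o),
    ∑ j, flow (.inr o) x j = N.inflow o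
  outflow_empty : ∀ e : E, ∀ x ∈ N.localDomain (.inl e), ∀ k, k.1 = e → x k = 0 →
    ∑ j, flow (.inl e) x j = 0
  outflow_congested : ∀ e : E, ∀ x ∈ N.localDomain (.inl e), ∀ k, k.1 = e → x k = ∞ →
    ∑ j, flow (.inl e) x j = N.cap e
  flow_congested : ∀ i, ¬ N.IsDestination (N.head i) → ∀ x ∈ N.localDomain i,
    ∀ k : N.localLinks i, N.src k = N.head i → x k = ∞ → flow i x (.inl k) = 0

namespace RoutingPolicy

variable {N : FlowNetwork V E}

/-- Total flow out of the routing link `i`. -/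
def outflow (f : N.RoutingPolicy) (i : N.InLink) (x : N.LocalDensity i) : ℝ :=
  ∑ j, f.flow i x j

/-- A real local density vector, read in `[0,∞]`. -/
def ofLocal {i : N.InLink} (x : N.localLinks i → ℝ) : N.LocalDensity i :=
  fun k => ENNReal.ofReal (x k)

open Classical in
/-- Monotone policies: for almost every (finite) local density vector, the flow from `i` to a
downstream `j` has nonnegative partial derivatives with respect to the densities other than that
of `j`, and the total flow out of `i` has nonpositive partial derivatives with respect to the
densities of the links downstream of `i`. -/
def IsMonotone (f : N.RoutingPolicy) : Prop :=
  (∀ i j, N.tail j = N.head i → ∀ k : N.localLinks i, Sum.inl k.1 ≠ j →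
    ∀ᵐ x : N.localLinks i → ℝ ∂volume.restrict (Set.Ici 0),
      0 ≤ deriv (fun s => f.flow i (ofLocal (Function.update x k s)) j) (x k)) ∧
  (∀ i, ∀ k : N.localLinks i, N.src k = N.head i →
    ∀ᵐ x : N.localLinks i → ℝ ∂volume.restrict (Set.Ici 0),
      deriv (fun s => f.outflow i (ofLocal (Function.update x k s))) (x k) ≤ 0)

/-- Strongly monotone policies: the two monotonicities are strict, wherever the defining properties
of a routing policy do not force the quantity at hand to be constant. The flow from `i` to `j` is
constantly `0` where `j` is congested, and where `i` is an empty link of the network; the total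
flow out of `i` is constant where `i` is an empty or congested link of the network, and everywhere
if `i` comes from the external world. -/
def IsStronglyMonotone (f : N.RoutingPolicy) : Prop :=
  f.IsMonotone ∧
  (∀ i j, N.tail j = N.head i → ∀ k : N.localLinks i, Sum.inl k.1 ≠ j →
    ∀ x ∈ N.localDomain i, ∀ y ∈ N.localDomain i, (∀ l, l ≠ k → x l = y l) → x k < y k →
      (∀ l : N.localLinks i, Sum.inl l.1 = j → x l ≠ ∞) →
      (∀ l : N.localLinks i, Sum.inl l.1 = i → y l ≠ 0) →
      f.flow i x j < f.flow i y j) ∧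
  (∀ e : E, ∀ k : N.localLinks (.inl e), N.src k = N.tgt e →
    ∀ x ∈ N.localDomain (.inl e), ∀ y ∈ N.localDomain (.inl e),
      (∀ l, l ≠ k → x l = y l) → x k < y k →
      (∀ l : N.localLinks (.inl e), l.1 = e → x l ≠ 0 ∧ x l ≠ ∞) →
      f.outflow (.inl e) y < f.outflow (.inl e) x)

/-- The local density vector at `i` of a density vector of the whole network. -/
def restrict (ρ : E → ℝ) (i : N.InLink) : N.LocalDensity i := fun k => ENNReal.ofReal (ρ k)

/-- Right-hand side of the dynamics: total flow into the link `e` minus total flow out of it. -/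
def velocity (f : N.RoutingPolicy) (ρ : E → ℝ) (e : E) : ℝ :=
  ∑ i, f.flow i (restrict ρ i) (.inl e) - f.outflow (.inl e) (restrict ρ (.inl e))

/-- `ρ` solves the dynamical flow network on `[0,T)` from `ρ₀`, staying in `[0,∞)^E`. -/
structure IsSolution (f : N.RoutingPolicy) (T : ℝ≥0∞) (ρ₀ : E → ℝ) (ρ : ℝ → E → ℝ) : Prop where
  init : ρ 0 = ρ₀
  nonneg : ∀ t, 0 ≤ t → ENNReal.ofReal t < T → ∀ e, 0 ≤ ρ t e
  deriv : ∀ t, 0 ≤ t → ENNReal.ofReal t < T → ∀ e,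
    HasDerivWithinAt (fun s => ρ s e) (f.velocity (ρ t) e) (Set.Ici 0) t

/-- The maximal time up to which the solution from `ρ₀` exists and stays in `[0,∞)^E`. -/
def existenceTime (f : N.RoutingPolicy) (ρ₀ : E → ℝ) : ℝ≥0∞ :=
  sSup {T | ∃ ρ, f.IsSolution T ρ₀ ρ}

end RoutingPolicy

/-- Cuts: nonempty sets of non-destination nodes. -/
def IsCut (N : FlowNetwork V E) (U : Finset V) : Prop :=
  U.Nonempty ∧ ∀ v ∈ U, ¬ N.IsDestination v

open Classical in
/-- Links with tail in `U`. -/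
def linksFrom (N : FlowNetwork V E) (U : Finset V) : Finset E :=
  Finset.univ.filter fun e => N.src e ∈ U

open Classical in
/-- Links from `U` to its complement. -/
def outBoundary (N : FlowNetwork V E) (U : Finset V) : Finset E :=
  Finset.univ.filter fun e => N.src e ∈ U ∧ N.tgt e ∉ U

open Classical in
/-- Links from the complement of `U` to `U`. -/
def inBoundary (N : FlowNetwork V E) (U : Finset V) : Finset E :=
  Finset.univ.filter fun e => N.src e ∉ U ∧ N.tgt e ∈ U

/-- Aggregate inflow of `U` minus capacity of `U`. -/
def excess (N : FlowNetwork V E) (U : Finset V) : ℝ :=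
  ∑ v ∈ U, N.inflow v - ∑ e ∈ N.outBoundary U, N.cap e

/-- Cuts of maximal excess. -/
def IsMaxCut (N : FlowNetwork V E) (U : Finset V) : Prop :=
  N.IsCut U ∧ ∀ U', N.IsCut U' → N.excess U' ≤ N.excess U

open Classical in
/-- Union of all cuts of maximal excess. -/
def criticalSet (N : FlowNetwork V E) : Finset V :=
  Finset.univ.filter fun v => ∃ U, N.IsMaxCut U ∧ v ∈ U

end FlowNetwork

end

/-! The dynamics is a cooperative system: with the density of a link fixed, its inflow rises and its
outflow falls with the other densities (`isCooperative_velocity`). Hence trajectories preserve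
order. The trajectory from the empty network lies below its own time shifts, so it increases to a
limit `X` in `[0,∞]`, and it bounds every other trajectory from below.

Let `W` be the saturated set: the non-destination nodes all of whose outgoing links have `X = ∞`. In
the limit, flow into `W` from outside vanishes and links from `W` to outside run at capacity.
Combining the flow balance of `U \ W` with an inequality for `W \ U` shows that every set `U` of
non-destination nodes has excess at most that of `W`, strictly less if `U ⊄ W` (`excess_le_and_lt`).
Since the maximal excess is nonnegative, `W` is the critical set (`saturatedSet_eq`).

It remains to compare an arbitrary trajectory `y` with the minimal one `x ≤ y`. Mass leaves only
through links into destinations, whose outflow increases with their own density, so the ℓ¹ distance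
between `x` and `y` never increases. By Barbalat's lemma the difference of exit flows tends to 0,
which forces convergence on the links into destinations. Strong monotonicity carries the convergence
upstream (`tendsto_of_tendsto`), and it reaches every link with `X` finite because no set of
unsaturated non-destination nodes is closed off from the other unsaturated nodes (`exists_link`).
The bounded ℓ¹ distance also gives both trajectories the same growth rate on the links leaving `W`.
-/

noncomputable section

/-! ### Comparison, existence and asymptotics for differential equations -/

/-- The remainder is at most `h ^ 2` in each of the sign cases. Squaring makes the positive part
differentiable, so that Grönwall's inequality applies to it. -/
theorem hasDerivAt_sq_max_zero (r : ℝ) :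
    HasDerivAt (fun s : ℝ => max s 0 ^ 2) (2 * max r 0) r := by
  rw [hasDerivAt_iff_isLittleO_nhds_zero]
  refine Asymptotics.IsBigO.trans_isLittleO (g := fun h : ℝ => h ^ 2) ?_
    (by simpa using (Asymptotics.isLittleO_pow_id (𝕜 := ℝ) one_lt_two))
  refine Asymptotics.IsBigO.of_bound 1 (Eventually.of_forall fun h => ?_)
  rw [Real.norm_eq_abs, Real.norm_eq_abs, abs_of_nonneg (sq_nonneg h), one_mul, abs_le, smul_eq_mul]
  rcases le_total 0 r with hr | hr <;> rcases le_total 0 (r + h) with hh | hh <;>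
    simp only [max_eq_left, max_eq_right, hr, hh] <;> constructor <;>
    nlinarith [sq_nonneg (r + h), sq_nonneg h, sq_nonneg r]

/-- A vector field each of whose components is nondecreasing in all the other coordinates. -/
def IsCooperative {E : Type*} (F : (E → ℝ) → E → ℝ) : Prop :=
  ∀ x y : E → ℝ, ∀ e, x ≤ y → x e = y e → F x e ≤ F y e

/-- Pass through `x ⊔ y`, which agrees with `x` at `e`: cooperativity handles the step from `x`, the
Lipschitz bound the step down to `y`. -/
theorem IsCooperative.sub_le_of_lt {E : Type*} [Fintype E] {F : (E → ℝ) → E → ℝ} {K : ℝ≥0}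
    (hF : LipschitzWith K F) (hc : IsCooperative F) (x y : E → ℝ) (e : E) (h : y e ≤ x e) :
    F x e - F y e ≤ K * ∑ k, max (x k - y k) 0 := by
  have h1 : F x e ≤ F (x ⊔ y) e := hc _ _ _ le_sup_left (by simp [h])
  have h2 : F (x ⊔ y) e - F y e ≤ K * dist (x ⊔ y) y :=
    (le_abs_self _).trans <| (dist_le_pi_dist (F (x ⊔ y)) (F y) e).trans (hF.dist_le_mul _ _)
  have h3 : dist (x ⊔ y) y ≤ ∑ k, max (x k - y k) 0 := by
    refine (dist_pi_le_iff (Finset.sum_nonneg fun k _ => le_max_right _ _)).2 fun k => ?_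
    have : dist ((x ⊔ y) k) (y k) = max (x k - y k) 0 := by
      rw [Real.dist_eq, Pi.sup_apply, abs_of_nonneg (by simp), ← max_sub_sub_right, sub_self]
    rw [this]
    exact Finset.single_le_sum (f := fun k => max (x k - y k) 0)
      (fun k _ => le_max_right _ _) (Finset.mem_univ k)
  have := mul_le_mul_of_nonneg_left h3 K.coe_nonneg
  linarith

/-- Comparison of a subsolution with a supersolution of a cooperative system. -/
theorem IsCooperative.le_of_subsolution_of_supersolution {E : Type*} [Fintype E]
    {F : (E → ℝ) → E → ℝ} {K : ℝ≥0}
    (hF : LipschitzWith K F) (hc : IsCooperative F) {T : ℝ} {x y x' y' : ℝ → E → ℝ}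
    (hx : ∀ t ∈ Set.Icc 0 T, ∀ e, HasDerivWithinAt (fun s => x s e) (x' t e) (Set.Ici 0) t)
    (hy : ∀ t ∈ Set.Icc 0 T, ∀ e, HasDerivWithinAt (fun s => y s e) (y' t e) (Set.Ici 0) t)
    (hx' : ∀ t ∈ Set.Icc 0 T, ∀ e, x' t e ≤ F (x t) e)
    (hy' : ∀ t ∈ Set.Icc 0 T, ∀ e, F (y t) e ≤ y' t e) (h0 : x 0 ≤ y 0) :
    ∀ t ∈ Set.Icc 0 T, x t ≤ y t := by
  -- `ψ` measures the violation of `x ≤ y`. It starts at 0 and satisfies a linear differential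
  -- inequality, so it stays 0.
  set ψ : ℝ → ℝ := fun t => ∑ e, max (x t e - y t e) 0 ^ 2 with hψ
  set ψ' : ℝ → ℝ := fun t => ∑ e, 2 * max (x t e - y t e) 0 * (x' t e - y' t e) with hψ'
  have hd : ∀ t ∈ Set.Icc 0 T, HasDerivWithinAt ψ (ψ' t) (Set.Ici 0) t := fun t ht =>
    HasDerivWithinAt.fun_sum fun e _ =>
      (hasDerivAt_sq_max_zero _).comp_hasDerivWithinAt t ((hx t ht e).sub (hy t ht e))
  have hb : ∀ t ∈ Set.Icc 0 T, ψ' t ≤ (2 * K * Fintype.card E) * ψ t + 0 := by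
    intro t ht
    have h1 : ψ' t ≤ ∑ e, 2 * max (x t e - y t e) 0 * (K * ∑ k, max (x t k - y t k) 0) := by
      refine Finset.sum_le_sum fun e _ => ?_
      rcases le_total (x t e) (y t e) with h | h
      · simp [max_eq_right (sub_nonpos.2 h)]
      · refine mul_le_mul_of_nonneg_left ?_ (by positivity)
        linarith [hc.sub_le_of_lt hF (x t) (y t) e h, hx' t ht e, hy' t ht e]
    -- Cauchy–Schwarz turns the squared sum into `ψ`, whence the factor `card E` in the Grönwall
    -- constant.
    have h2 := sq_sum_le_card_mul_sum_sq (s := Finset.univ) (f := fun e => max (x t e - y t e) 0)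
    rw [← Finset.sum_mul, ← Finset.mul_sum] at h1
    have h3 := mul_le_mul_of_nonneg_left h2 K.coe_nonneg
    simp only [Finset.card_univ] at h3
    simp only [hψ]
    nlinarith
  have hg := le_gronwallBound_of_liminf_deriv_right_le (f := ψ) (f' := ψ') (δ := 0)
    (K := 2 * K * Fintype.card E) (ε := 0) (a := 0) (b := T)
    (fun t ht => (hd t ht).continuousWithinAt.mono fun s hs => hs.1)
    (fun t ht r hr => ((hd t ⟨ht.1, ht.2.le⟩).mono
      (Set.Ici_subset_Ici.2 ht.1)).liminf_right_slope_le hr)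
    (by simp only [hψ]; exact (Finset.sum_eq_zero fun e _ => by simp [h0 e]).le)
    (fun t ht => hb t ⟨ht.1, ht.2.le⟩)
  intro t ht e
  have h1 := hg t ht
  rw [gronwallBound_ε0_δ0] at h1
  have h2 := (Finset.sum_eq_zero_iff_of_nonneg fun e _ => sq_nonneg _).1
    (le_antisymm h1 (Finset.sum_nonneg fun e _ => sq_nonneg _)) e (Finset.mem_univ e)
  simpa using h2

/-- A bounded, globally Lipschitz vector field has global forward trajectories. -/
theorem exists_forall_hasDerivWithinAt_of_lipschitzWith {X : Type*} [NormedAddCommGroup X]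
    [NormedSpace ℝ X] [CompleteSpace X] {F : X → X} {K L : ℝ≥0} (hF : LipschitzWith K F)
    (hL : ∀ x, ‖F x‖ ≤ L) (x₀ : X) :
    ∃ x : ℝ → X, x 0 = x₀ ∧ ∀ t, 0 ≤ t → HasDerivWithinAt x (F (x t)) (Set.Ici 0) t := by
  have key : ∀ n : ℕ, ∃ α : ℝ → X, α 0 = x₀ ∧
      ∀ t ∈ Set.Icc (0 : ℝ) n, HasDerivWithinAt α (F (α t)) (Set.Icc 0 n) t := by
    intro n
    -- At speed at most `L`, the ball of radius `L * n` is not left before time `n`.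
    have hp : IsPicardLindelof (fun _ => F) (tmin := 0) (tmax := n) ⟨0, by simp⟩ x₀ (L * n) 0 L K :=
      IsPicardLindelof.of_time_independent (fun x _ => hL x) hF.lipschitzOnWith (by simp)
    exact hp.exists_eq_forall_mem_Icc_hasDerivWithinAt₀
  choose α hα0 hα using key
  have hcont : ∀ n, ContinuousOn (α n) (Set.Icc 0 n) := fun n t ht =>
    (hα n t ht).continuousWithinAt
  have hright : ∀ n : ℕ, ∀ t ∈ Set.Ico (0 : ℝ) n,
      HasDerivWithinAt (α n) (F (α n t)) (Set.Ici t) t := fun n t ht =>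
    (hα n t ⟨ht.1, ht.2.le⟩).mono_of_mem_nhdsWithin
      (mem_of_superset (Icc_mem_nhdsGE ht.2) (Set.Icc_subset_Icc_left ht.1))
  have huniq : ∀ m n : ℕ, m ≤ n → Set.EqOn (α m) (α n) (Set.Icc 0 m) := by
    intro m n hmn
    have hmn' : (m : ℝ) ≤ n := by exact_mod_cast hmn
    exact ODE_solution_unique (v := fun _ => F) (fun _ => hF) (hcont m) (hright m)
      ((hcont n).mono (Set.Icc_subset_Icc_right hmn'))
      (fun t ht => hright n t ⟨ht.1, ht.2.trans_le hmn'⟩) (by rw [hα0, hα0])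
  have hglue : ∀ n : ℕ, ∀ t : ℝ, 0 ≤ t → t ≤ n → α ⌈t⌉₊ t = α n t := fun n t ht htn =>
    huniq _ _ (Nat.ceil_le.2 htn) ⟨ht, Nat.le_ceil t⟩
  refine ⟨fun t => α ⌈t⌉₊ t, by simp [hα0], fun t ht => ?_⟩
  obtain ⟨n, hn⟩ := exists_nat_gt t
  have hmem : Set.Icc 0 (n : ℝ) ∈ 𝓝[Set.Ici 0] t := by
    rw [← Set.Ici_inter_Iic]
    exact inter_mem self_mem_nhdsWithin (mem_nhdsWithin_of_mem_nhds (Iic_mem_nhds hn))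
  have h1 := (hα n t ⟨ht, hn.le⟩).mono_of_mem_nhdsWithin hmem
  simp only [hglue n t ht hn.le]
  refine h1.congr_of_eventuallyEq ?_ (hglue n t ht hn.le)
  filter_upwards [hmem] with s hs using hglue n s hs.1 hs.2

/-- Mean value inequality for `g t - c * t`. Barbalat's lemma takes for `c` one value of `g'`, the
growth rate takes the limit of `g'`. -/
theorem abs_sub_sub_mul_le_of_abs_deriv_sub_le {g g' : ℝ → ℝ} {a b c ε : ℝ} (ha : 0 ≤ a)
    (hab : a ≤ b)
    (hg : ∀ t, 0 ≤ t → HasDerivWithinAt g (g' t) (Set.Ici 0) t)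
    (hε : ∀ t ∈ Set.Icc a b, |g' t - c| ≤ ε) :
    |g b - g a - c * (b - a)| ≤ ε * (b - a) := by
  have h := (convex_Icc a b).norm_image_sub_le_of_norm_hasDerivWithin_le
    (f := fun t => g t - c * t) (f' := fun t => g' t - c) (C := ε) (x := a) (y := b)
    (fun t ht => ((hg t (ha.trans ht.1)).mono fun s hs => ha.trans hs.1).sub
      (by simpa using ((hasDerivAt_id t).const_mul c).hasDerivWithinAt))
    hε ⟨le_rfl, hab⟩ ⟨hab, le_rfl⟩
  rw [Real.norm_eq_abs, Real.norm_eq_abs, abs_of_nonneg (sub_nonneg.2 hab)] at h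
  convert h using 2
  ring

/-- Barbalat's lemma. -/
theorem tendsto_deriv_zero_of_tendsto {g g' : ℝ → ℝ} {K : ℝ≥0} {c : ℝ}
    (hg : ∀ t, 0 ≤ t → HasDerivWithinAt g (g' t) (Set.Ici 0) t)
    (hK : LipschitzOnWith K g' (Set.Ici 0)) (hc : Tendsto g atTop (𝓝 c)) :
    Tendsto g' atTop (𝓝 0) := by
  rw [Metric.tendsto_atTop]
  intro ε hε
  -- Over a window of length `h` the derivative varies by less than `ε / 2`; `K + 1` avoids division
  -- by zero. Values of `g` within `h * ε / 4` of `c` account for the other `ε / 2`.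
  set h : ℝ := ε / (2 * (K + 1)) with hh
  have hK0 : (0 : ℝ) ≤ K := K.coe_nonneg
  have hpos : 0 < h := by positivity
  have hKh : K * h < ε / 2 := by
    rw [hh, mul_div_assoc', div_lt_div_iff₀ (by positivity) (by positivity)]
    nlinarith
  obtain ⟨T, hT⟩ := Metric.tendsto_atTop.1 hc (h * ε / 4) (by positivity)
  refine ⟨max T 0, fun t ht => ?_⟩
  have ht0 : 0 ≤ t := (le_max_right _ _).trans ht
  have htT : T ≤ t := (le_max_left _ _).trans ht
  have h1 := hT t htT
  have h2 := hT (t + h) (by linarith)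
  rw [Real.dist_eq, abs_lt] at h1 h2
  have h3 := abs_sub_sub_mul_le_of_abs_deriv_sub_le (c := g' t) (ε := K * h) ht0
    (show t ≤ t + h by linarith) hg (fun s hs => by
      have := hK.dist_le_mul s (ht0.trans hs.1) t ht0
      rw [Real.dist_eq, Real.dist_eq, abs_of_nonneg (sub_nonneg.2 hs.1)] at this
      exact this.trans (mul_le_mul_of_nonneg_left (by linarith [hs.2]) hK0))
  rw [add_sub_cancel_left, abs_le] at h3
  rw [Real.dist_eq, sub_zero, abs_lt]
  constructor <;> nlinarith

/-- A function whose derivative tends to `c` grows linearly at rate `c`. -/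
theorem tendsto_div_of_tendsto_deriv {g g' : ℝ → ℝ} {c : ℝ}
    (hg : ∀ t, 0 ≤ t → HasDerivWithinAt g (g' t) (Set.Ici 0) t)
    (hc : Tendsto g' atTop (𝓝 c)) : Tendsto (fun t => 1 / t * g t) atTop (𝓝 c) := by
  rw [Metric.tendsto_atTop]
  intro ε hε
  obtain ⟨T₀, hT₀⟩ := Metric.tendsto_atTop.1 hc (ε / 2) (by positivity)
  set T := max T₀ 0
  have hT0 : 0 ≤ T := le_max_right _ _
  set A := |g T - c * T|
  have hA : 0 ≤ A := abs_nonneg _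
  refine ⟨max (T + 1) (2 * A / ε + 1), fun t ht => ?_⟩
  have ht1 : T + 1 ≤ t := (le_max_left _ _).trans ht
  have ht2 : 2 * A / ε + 1 ≤ t := (le_max_right _ _).trans ht
  have h1 := abs_sub_sub_mul_le_of_abs_deriv_sub_le (c := c) (ε := ε / 2) hT0
    (show T ≤ t by linarith) hg (fun s hs => by
      have := hT₀ s ((le_max_left _ _).trans hs.1)
      rw [Real.dist_eq] at this
      exact this.le)
  have htpos : 0 < t := by linarith
  have h2 : A < ε / 2 * t := by
    have : 2 * A / ε < t := by linarith
    rw [div_lt_iff₀ hε] at this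
    linarith
  have h3 : |g t - c * t| < ε * t := by
    have : g t - c * t = (g t - g T - c * (t - T)) + (g T - c * T) := by ring
    rw [this]
    refine (abs_add_le _ _).trans_lt ?_
    nlinarith
  rw [Real.dist_eq, show 1 / t * g t - c = (g t - c * t) / t by field_simp, abs_div,
    abs_of_pos htpos, div_lt_iff₀ htpos]
  exact h3

/-! ### Local densities and flows at possibly congested states -/

namespace FlowNetwork

variable {V E : Type*} {N : FlowNetwork V E}

theorem not_isDestination_src (e : E) : ¬ N.IsDestination (N.src e) := fun h => h e rfl

theorem not_isDestination_of_isOrigin {v : V} (hv : N.IsOrigin v) : ¬ N.IsDestination v :=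
  fun h => hv.ne' (N.inflow_destination v h)

/-- A node of the network is the head of some routing link, since it is reachable from the external
world. -/
theorem IsConnected.exists_head_eq (hN : N.IsConnected) (v : V) :
    ∃ i : N.InLink, N.head i = v := by
  rcases Relation.ReflTransGen.cases_tail (hN.2 none (some v)) with h | ⟨b, -, hb⟩
  · simp at h
  · rcases b with _ | u
    · exact ⟨.inr ⟨v, hb⟩, rfl⟩
    · obtain ⟨e, -, he⟩ := hb
      exact ⟨.inl e, he⟩

section

variable [Fintype E]

theorem mem_localLinks {i : N.InLink} {k : E} :
    k ∈ N.localLinks i ↔ N.src k = N.head i ∨ Sum.inl k = i := by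
  simp [localLinks]

theorem mem_linksFrom {U : Finset V} {e : E} : e ∈ N.linksFrom U ↔ N.src e ∈ U := by
  simp [linksFrom]

theorem mem_outBoundary {U : Finset V} {e : E} :
    e ∈ N.outBoundary U ↔ N.src e ∈ U ∧ N.tgt e ∉ U := by
  simp [outBoundary]

theorem mem_inBoundary {U : Finset V} {e : E} :
    e ∈ N.inBoundary U ↔ N.src e ∉ U ∧ N.tgt e ∈ U := by
  simp [inBoundary]

/-- The part of a density vector of the whole network that is visible to `i`. -/
def localize (X : E → ℝ≥0∞) (i : N.InLink) : N.LocalDensity i := fun k => X k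

theorem localize_mem_localDomain {X : E → ℝ≥0∞} {i : N.InLink} :
    localize X i ∈ N.localDomain i ↔
      N.IsDestination (N.head i) ∨ ∃ k, (N.src k = N.head i ∨ Sum.inl k = i) ∧ X k ≠ ∞ := by
  refine or_congr Iff.rfl ⟨fun ⟨k, hk⟩ => ⟨k, mem_localLinks.1 k.2, hk⟩,
    fun ⟨k, hk, h⟩ => ⟨⟨k, mem_localLinks.2 hk⟩, h⟩⟩

theorem localize_mem_localDomain_of_le {X Y : E → ℝ≥0∞} {i : N.InLink} (hXY : X ≤ Y)
    (hY : localize Y i ∈ N.localDomain i) : localize X i ∈ N.localDomain i := by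
  rw [localize_mem_localDomain] at *
  exact hY.imp_right fun ⟨k, hk, h⟩ => ⟨k, hk, ne_top_of_le_ne_top h (hXY k)⟩

theorem localize_mem_localDomain_of_finite {X : E → ℝ≥0∞} (hX : ∀ e, X e ≠ ∞) (i : N.InLink) :
    localize X i ∈ N.localDomain i := by
  rw [localize_mem_localDomain]
  rcases i with e | o
  · exact .inr ⟨e, .inr rfl, hX e⟩
  · have := not_isDestination_of_isOrigin o.2
    rw [IsDestination, not_forall_not] at this
    obtain ⟨e, he⟩ := this
    exact .inr ⟨e, .inl he, hX e⟩

theorem RoutingPolicy.restrict_mem_localDomain (ρ : E → ℝ) (i : N.InLink) :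
    RoutingPolicy.restrict ρ i ∈ N.localDomain i :=
  localize_mem_localDomain_of_finite (fun _ => ENNReal.ofReal_ne_top) i

end

variable [Fintype V] [Fintype E]

namespace RoutingPolicy

variable {f : N.RoutingPolicy}

theorem outflow_nonneg {i : N.InLink} {x : N.LocalDensity i} (hx : x ∈ N.localDomain i) :
    0 ≤ f.outflow i x :=
  Finset.sum_nonneg fun j _ => f.flow_nonneg i x hx j

theorem flow_le_outflow {i : N.InLink} {x : N.LocalDensity i} (hx : x ∈ N.localDomain i)
    (j : N.OutLink) : f.flow i x j ≤ f.outflow i x :=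
  Finset.single_le_sum (f := fun j => f.flow i x j) (fun j _ => f.flow_nonneg i x hx j)
    (Finset.mem_univ j)

theorem outflow_localize_of_eq_zero {X : E → ℝ≥0∞} {e : E}
    (hX : localize X (.inl e) ∈ N.localDomain (.inl e)) (h : X e = 0) :
    f.outflow (.inl e) (localize X (.inl e)) = 0 :=
  f.outflow_empty e _ hX ⟨e, mem_localLinks.2 (.inr rfl)⟩ rfl h

theorem outflow_localize_of_eq_top {X : E → ℝ≥0∞} {e : E}
    (hX : localize X (.inl e) ∈ N.localDomain (.inl e)) (h : X e = ∞) :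
    f.outflow (.inl e) (localize X (.inl e)) = N.cap e :=
  f.outflow_congested e _ hX ⟨e, mem_localLinks.2 (.inr rfl)⟩ rfl h

theorem flow_localize_of_eq_top {X : E → ℝ≥0∞} {i : N.InLink}
    (hX : localize X i ∈ N.localDomain i) {k : E} (hk : N.src k = N.head i) (h : X k = ∞) :
    f.flow i (localize X i) (.inl k) = 0 :=
  f.flow_congested i (hk ▸ not_isDestination_src k) _ hX ⟨k, mem_localLinks.2 (.inl hk)⟩ hk h

theorem outflow_localize_of_forall_eq_top {X : E → ℝ≥0∞} {i : N.InLink}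
    (hX : localize X i ∈ N.localDomain i) (hi : ¬ N.IsDestination (N.head i))
    (h : ∀ k, N.src k = N.head i → X k = ∞) : f.outflow i (localize X i) = 0 := by
  refine Finset.sum_eq_zero fun j _ => ?_
  by_cases hj : N.tail j = N.head i
  · rcases j with k | d
    · exact flow_localize_of_eq_top hX hj (h k hj)
    · exact absurd (hj ▸ d.2) hi
  · exact f.flow_eq_zero i _ hX j hj

/-- Policies are continuous up to infinite densities, so flows converge even where densities
diverge, as long as the limit lies in the local domain. -/
theorem tendsto_flow {α : Type*} {F : Filter α} {ρ : α → E → ℝ} {X : E → ℝ≥0∞}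
    (h : ∀ e, Tendsto (fun t => ENNReal.ofReal (ρ t e)) F (𝓝 (X e))) {i : N.InLink}
    (hX : localize X i ∈ N.localDomain i) (j : N.OutLink) :
    Tendsto (fun t => f.flow i (restrict (ρ t) i) j) F (𝓝 (f.flow i (localize X i) j)) := by
  have h1 : Tendsto (fun t => restrict (ρ t) i) F (𝓝 (localize X i)) :=
    tendsto_pi_nhds.2 fun k => h k
  exact (f.continuousOn i j _ hX).tendsto.comp
    (tendsto_nhdsWithin_iff.2 ⟨h1, Eventually.of_forall fun t => restrict_mem_localDomain _ i⟩)

theorem tendsto_outflow {α : Type*} {F : Filter α} {ρ : α → E → ℝ} {X : E → ℝ≥0∞}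
    (h : ∀ e, Tendsto (fun t => ENNReal.ofReal (ρ t e)) F (𝓝 (X e))) {i : N.InLink}
    (hX : localize X i ∈ N.localDomain i) :
    Tendsto (fun t => f.outflow i (restrict (ρ t) i)) F (𝓝 (f.outflow i (localize X i))) :=
  tendsto_finsetSum _ fun j _ => tendsto_flow h hX j

/-! ### Weak and strict monotonicity on the extended densities -/

section Monotone

/-- Strict monotonicity applies except where `j` is congested or `i` is empty, and there the
left-hand flow is 0. -/
theorem flow_update_le (hf : f.IsStronglyMonotone) {i : N.InLink} {j : N.OutLink}
    {k : N.localLinks i} (hk : Sum.inl k.1 ≠ j) {x y : N.LocalDensity i}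
    (hx : x ∈ N.localDomain i) (hy : y ∈ N.localDomain i) (hxy : ∀ l, l ≠ k → x l = y l)
    (hle : x k ≤ y k) : f.flow i x j ≤ f.flow i y j := by
  by_cases hj : N.tail j = N.head i
  swap
  · rw [f.flow_eq_zero i x hx j hj, f.flow_eq_zero i y hy j hj]
  rcases hle.eq_or_lt with heq | hlt
  · have : x = y := funext fun l => by
      by_cases h : l = k
      · rw [h, heq]
      · exact hxy l h
    rw [this]
  by_cases h1 : ∀ l : N.localLinks i, Sum.inl l.1 = j → x l ≠ ∞
  · by_cases h2 : ∀ l : N.localLinks i, Sum.inl l.1 = i → y l ≠ 0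
    · exact (hf.2.1 i j hj k hk x hx y hy hxy hlt h1 h2).le
    · push Not at h2
      obtain ⟨⟨e, he⟩, hei, hl0⟩ := h2
      change Sum.inl e = i at hei
      subst hei
      have hlk : (⟨e, he⟩ : N.localLinks (.inl e)) ≠ k := fun h => by
        rw [← h, hl0] at hlt
        exact not_lt_zero hlt
      refine ((flow_le_outflow hx j).trans_eq ?_).trans (f.flow_nonneg _ y hy j)
      exact f.outflow_empty e x hx ⟨e, he⟩ rfl ((hxy _ hlk).trans hl0)
  · push Not at h1
    obtain ⟨l, rfl, hl⟩ := h1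
    rw [f.flow_congested i (hj ▸ not_isDestination_src l.1) x hx l hj hl]
    exact f.flow_nonneg _ y hy _

/-- Coordinates are raised one at a time. The intermediate vectors lie below `Y`, hence in the local
domain. -/
theorem flow_mono (hf : f.IsStronglyMonotone) {i : N.InLink} {j : N.OutLink}
    {X Y : E → ℝ≥0∞} (hXY : X ≤ Y) (hY : localize Y i ∈ N.localDomain i)
    (hj : ∀ k, Sum.inl k = j → X k = Y k) :
    f.flow i (localize X i) j ≤ f.flow i (localize Y i) j := by
  classical
  suffices h : ∀ s : Finset E,
      f.flow i (localize X i) j ≤ f.flow i (localize (s.piecewise Y X) i) j by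
    simpa using h Finset.univ
  intro s
  induction s using Finset.induction_on with
  | empty => simp
  | insert k s hks ih =>
    refine ih.trans ?_
    have hle : s.piecewise Y X ≤ (insert k s).piecewise Y X := by
      intro l
      by_cases hl : l = k
      · subst hl; simpa [hks] using hXY l
      · simp [Finset.piecewise_insert_of_ne _ _ _ hl]
    have hY' : localize ((insert k s).piecewise Y X) i ∈ N.localDomain i :=
      localize_mem_localDomain_of_le (Finset.piecewise_le_of_le_of_le _ le_rfl hXY) hY
    by_cases hk : k ∈ N.localLinks i ∧ Sum.inl k ≠ j
    · exact flow_update_le hf (k := ⟨k, hk.1⟩) hk.2 (localize_mem_localDomain_of_le hle hY') hY'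
        (fun l hl => (Finset.piecewise_insert_of_ne _ _ _ fun h => hl (Subtype.ext h)).symm)
        (hle k)
    · refine le_of_eq (congrArg (fun x => f.flow i x j) (funext fun l => ?_))
      by_cases hl : l.1 = k
      · have : X k = Y k := hj k (by
          by_contra h
          exact hk ⟨hl ▸ l.2, h⟩)
        simp [localize, hl, hks, this]
      · simp [localize, Finset.piecewise_insert_of_ne _ _ _ hl]

/-- Raise coordinate `k` first, with a strict gain, then the others weakly. Nonemptiness of `i` need
not be assumed when `k` is `i` itself, since `Y k > X k`. -/
theorem flow_lt (hf : f.IsStronglyMonotone) {i : N.InLink} {j : N.OutLink}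
    {X Y : E → ℝ≥0∞} (hXY : X ≤ Y) (hY : localize Y i ∈ N.localDomain i)
    (hj : ∀ k, Sum.inl k = j → X k = Y k ∧ X k ≠ ∞) (hji : N.tail j = N.head i)
    {k : E} (hk : N.src k = N.head i ∨ Sum.inl k = i) (hkj : Sum.inl k ≠ j)
    (hlt : X k < Y k) (hik : ∀ l, Sum.inl l = i → l ≠ k → X l ≠ 0) :
    f.flow i (localize X i) j < f.flow i (localize Y i) j := by
  classical
  have h1 : X ≤ Function.update X k (Y k) := le_update_iff.2 ⟨hlt.le, fun _ _ => le_rfl⟩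
  have h2 : Function.update X k (Y k) ≤ Y := update_le_iff.2 ⟨le_rfl, fun l _ => hXY l⟩
  have hZ := localize_mem_localDomain_of_le h2 hY
  refine lt_of_lt_of_le ?_ (flow_mono hf h2 hY fun l hl => ?_)
  · refine hf.2.1 i j hji ⟨k, mem_localLinks.2 hk⟩ hkj _ (localize_mem_localDomain_of_le h1 hZ)
      _ hZ ?_ ?_ ?_ ?_
    · intro l hl
      have : l.1 ≠ k := fun h => hl (Subtype.ext h)
      simp [localize, this]
    · simpa [localize] using hlt
    · exact fun l hl => (hj l hl).2
    · intro l hl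
      by_cases h : l.1 = k
      · simpa [localize, h] using hlt.ne_bot
      · simpa [localize, h] using hik l hl h
  · by_cases h : l = k
    · exact absurd (h ▸ hl) hkj
    · simpa [h] using (hj l hl).1

/-- If `e` is empty or congested the outflow is the constant 0 or `N.cap e`; otherwise the
downstream coordinates are raised one at a time. -/
theorem outflow_anti (hf : f.IsStronglyMonotone) {e : E} {X Y : E → ℝ≥0∞} (hXY : X ≤ Y)
    (hY : localize Y (.inl e) ∈ N.localDomain (.inl e)) (he : X e = Y e) :
    f.outflow (.inl e) (localize Y (.inl e)) ≤ f.outflow (.inl e) (localize X (.inl e)) := by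
  classical
  have hX := localize_mem_localDomain_of_le hXY hY
  by_cases h0 : X e = 0
  · rw [outflow_localize_of_eq_zero hX h0, outflow_localize_of_eq_zero hY (he ▸ h0)]
  by_cases htop : X e = ∞
  · rw [outflow_localize_of_eq_top hX htop, outflow_localize_of_eq_top hY (he ▸ htop)]
  suffices h : ∀ s : Finset E, f.outflow (.inl e) (localize (s.piecewise Y X) (.inl e)) ≤
      f.outflow (.inl e) (localize X (.inl e)) by
    simpa using h Finset.univ
  intro s
  induction s using Finset.induction_on with
  | empty => simp
  | insert k s hks ih =>
    refine le_trans ?_ ih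
    have hle : s.piecewise Y X ≤ (insert k s).piecewise Y X := by
      intro l
      by_cases hl : l = k
      · subst hl; simpa [hks] using hXY l
      · simp [Finset.piecewise_insert_of_ne _ _ _ hl]
    have hY' : localize ((insert k s).piecewise Y X) (.inl e) ∈ N.localDomain (.inl e) :=
      localize_mem_localDomain_of_le (Finset.piecewise_le_of_le_of_le _ le_rfl hXY) hY
    by_cases hk : N.src k = N.tgt e ∧ X k < Y k
    · refine (hf.2.2 e ⟨k, mem_localLinks.2 (.inl hk.1)⟩ hk.1 _
        (localize_mem_localDomain_of_le hle hY') _ hY' ?_ ?_ ?_).le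
      · exact fun l hl =>
          (Finset.piecewise_insert_of_ne _ _ _ fun h => hl (Subtype.ext h)).symm
      · simpa [localize, hks] using hk.2
      · intro l hl
        have : (s.piecewise Y X) l = X e := by
          rw [hl]
          by_cases h : e ∈ s <;> simp [h, he]
        simp only [localize, this]
        exact ⟨h0, htop⟩
    · refine le_of_eq (congrArg (fun x => f.outflow (.inl e) x) (funext fun l => ?_))
      by_cases hl : l.1 = k
      · have : X k = Y k := by
          rcases mem_localLinks.1 l.2 with h | h
          · by_contra hne
            exact hk ⟨hl ▸ h, (hXY k).lt_of_ne hne⟩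
          · rw [← hl, Sum.inl_injective h, he]
        simp [localize, hl, hks, this]
      · simp [localize, Finset.piecewise_insert_of_ne _ _ _ hl]

theorem outflow_mono_self (hf : f.IsStronglyMonotone) {e : E} {X Y : E → ℝ≥0∞} (hXY : X ≤ Y)
    (hY : localize Y (.inl e) ∈ N.localDomain (.inl e))
    (hne : ∀ k, N.src k = N.tgt e → X k = Y k) :
    f.outflow (.inl e) (localize X (.inl e)) ≤ f.outflow (.inl e) (localize Y (.inl e)) := by
  refine Finset.sum_le_sum fun j _ => ?_
  by_cases hj : N.tail j = N.tgt e
  · exact flow_mono hf hXY hY fun k hk => hne k (by rw [← hj, ← hk]; rfl)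
  · exact (f.flow_eq_zero (.inl e) _ (localize_mem_localDomain_of_le hXY hY) j hj).trans_le
      (f.flow_nonneg _ _ hY j)

/-- The outflow of a link is strictly increasing in its density unless all links downstream are
congested. -/
theorem outflow_lt_self (hf : f.IsStronglyMonotone) {e : E} {X Y : E → ℝ≥0∞} (hXY : X ≤ Y)
    (hY : localize Y (.inl e) ∈ N.localDomain (.inl e))
    (hne : ∀ k, N.src k = N.tgt e → X k = Y k) (hlt : X e < Y e)
    (hfree : N.IsDestination (N.tgt e) ∨ ∃ k, N.src k = N.tgt e ∧ X k ≠ ∞) :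
    f.outflow (.inl e) (localize X (.inl e)) < f.outflow (.inl e) (localize Y (.inl e)) := by
  -- One receiver that is not congested suffices: its flow grows strictly and no other flow
  -- decreases.
  have hex : ∃ j : N.OutLink, N.tail j = N.tgt e ∧ ∀ k, Sum.inl k = j → X k ≠ ∞ := by
    rcases hfree with h | ⟨k, hk, hk'⟩
    · exact ⟨.inr ⟨_, h⟩, rfl, by simp⟩
    · exact ⟨.inl k, hk, by simpa using hk'⟩
  obtain ⟨j, hj, hjt⟩ := hex
  refine Finset.sum_lt_sum (fun j _ => ?_) ⟨j, Finset.mem_univ j, ?_⟩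
  · by_cases hj : N.tail j = N.tgt e
    · exact flow_mono hf hXY hY fun k hk => hne k (by rw [← hj, ← hk]; rfl)
    · exact (f.flow_eq_zero (.inl e) _ (localize_mem_localDomain_of_le hXY hY) j hj).trans_le
        (f.flow_nonneg _ _ hY j)
  · refine flow_lt hf hXY hY (fun k hk => ⟨hne k (by rw [← hj, ← hk]; rfl), hjt k hk⟩) hj
      (.inr rfl) ?_ hlt ?_
    · rintro rfl
      exact N.no_self_loop e hj
    · rintro k hk hke
      exact absurd (Sum.inl_injective hk) hke

/-- Compare with the state in which `e` is emptied. -/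
theorem flow_pos (hf : f.IsStronglyMonotone) {e : E} {j : N.OutLink} {X : E → ℝ≥0∞}
    (hX : localize X (.inl e) ∈ N.localDomain (.inl e)) (hj : ∀ k, Sum.inl k = j → X k ≠ ∞)
    (hje : N.tail j = N.tgt e) (he : X e ≠ 0) : 0 < f.flow (.inl e) (localize X (.inl e)) j := by
  classical
  have hle : Function.update X e 0 ≤ X := update_le_iff.2 ⟨zero_le, fun _ _ => le_rfl⟩
  have hej : Sum.inl e ≠ j := by
    rintro rfl
    exact N.no_self_loop e hje
  refine (f.flow_nonneg _ _ (localize_mem_localDomain_of_le hle hX) j).trans_lt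
    (flow_lt hf hle hX (fun k hk => ?_) hje (.inr rfl) hej ?_ ?_)
  · have : k ≠ e := fun h => hej (h ▸ hk)
    simpa [this] using hj k hk
  · simpa using pos_iff_ne_zero.2 he
  · intro k hk hke
    exact absurd (Sum.inl_injective hk) hke

theorem outflow_pos (hf : f.IsStronglyMonotone) {e : E} {X : E → ℝ≥0∞} (he : X e ≠ 0)
    (hfree : N.IsDestination (N.tgt e) ∨ ∃ k, N.src k = N.tgt e ∧ X k ≠ ∞) :
    0 < f.outflow (.inl e) (localize X (.inl e)) := by
  have hX : localize X (.inl e) ∈ N.localDomain (.inl e) :=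
    localize_mem_localDomain.2 (hfree.imp_right fun ⟨k, hk, h⟩ => ⟨k, .inl hk, h⟩)
  rcases hfree with h | ⟨k, hk, hk'⟩
  · exact (flow_pos hf hX (j := .inr ⟨_, h⟩) (by simp) rfl he).trans_le (flow_le_outflow hX _)
  · exact (flow_pos hf hX (j := .inl k) (by simpa using hk') hk he).trans_le
      (flow_le_outflow hX _)

/-- Compare with the state in which `e` is congested. -/
theorem outflow_lt_cap (hf : f.IsStronglyMonotone) {e : E} {X : E → ℝ≥0∞} (he : X e ≠ ∞)
    (hfree : N.IsDestination (N.tgt e) ∨ ∃ k, N.src k = N.tgt e ∧ X k ≠ ∞) :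
    f.outflow (.inl e) (localize X (.inl e)) < N.cap e := by
  classical
  have hle : X ≤ Function.update X e ∞ := le_update_iff.2 ⟨le_top, fun _ _ => le_rfl⟩
  have hne : ∀ k, N.src k = N.tgt e → X k = Function.update X e ∞ k := fun k hk => by
    have : k ≠ e := fun h => N.no_self_loop e (h ▸ hk)
    simp [this]
  have hY : localize (Function.update X e ∞) (.inl e) ∈ N.localDomain (.inl e) :=
    localize_mem_localDomain.2 (hfree.imp_right fun ⟨k, hk, h⟩ => ⟨k, .inl hk, hne k hk ▸ h⟩)
  refine (outflow_lt_self hf hle hY hne (by simpa using he.lt_top) hfree).trans_eq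
    (outflow_localize_of_eq_top hY (by simp))

end Monotone

/-! ### The vector field: cooperativity, Lipschitz bounds, conservation of mass -/

section Velocity

theorem isCooperative_velocity (hf : f.IsStronglyMonotone) : IsCooperative f.velocity := by
  intro x y e hxy he
  have hle : (fun k => ENNReal.ofReal (x k)) ≤ fun k => ENNReal.ofReal (y k) :=
    fun k => ENNReal.ofReal_le_ofReal (hxy k)
  refine sub_le_sub (Finset.sum_le_sum fun i _ => ?_) ?_
  · exact flow_mono hf hle (restrict_mem_localDomain y i) fun k hk => by
      rw [Sum.inl_injective hk, he]
  · exact outflow_anti hf hle (restrict_mem_localDomain y _) (by rw [he])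

/-- `restrict` reads negative densities as 0, a 1-Lipschitz operation, so the field is Lipschitz on
all of `E → ℝ` and solutions exist before their nonnegativity is known. -/
theorem exists_lipschitzWith_flow (f : N.RoutingPolicy) (i : N.InLink) (j : N.OutLink) :
    ∃ K, LipschitzWith K fun ρ : E → ℝ => f.flow i (restrict ρ i) j := by
  obtain ⟨K, hK⟩ := f.lipschitz i j
  have h : LipschitzWith 1 fun (ρ : E → ℝ) (k : N.localLinks i) => (ρ k).toNNReal :=
    LipschitzWith.of_dist_le_mul fun x y => by
      rw [NNReal.coe_one, one_mul]
      refine (dist_pi_le_iff dist_nonneg).2 fun k => ?_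
      have := Real.lipschitzWith_toNNReal.dist_le_mul (x k) (y k)
      rw [NNReal.coe_one, one_mul] at this
      exact this.trans (dist_le_pi_dist x y k)
  exact ⟨K * 1, hK.comp h⟩

theorem exists_lipschitzWith_sum {ι X : Type*} [PseudoEMetricSpace X] (s : Finset ι)
    {g : ι → X → ℝ} (h : ∀ i ∈ s, ∃ K, LipschitzWith K (g i)) :
    ∃ K, LipschitzWith K fun x => ∑ i ∈ s, g i x := by
  classical
  induction s using Finset.induction_on with
  | empty => exact ⟨0, by simp⟩
  | insert a s ha ih =>
    obtain ⟨K, hK⟩ := ih fun i hi => h i (Finset.mem_insert_of_mem hi)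
    obtain ⟨K', hK'⟩ := h a (Finset.mem_insert_self a s)
    exact ⟨K' + K, by simpa only [Finset.sum_insert ha] using hK'.add hK⟩

theorem exists_lipschitzWith_outflow (f : N.RoutingPolicy) (i : N.InLink) :
    ∃ K, LipschitzWith K fun ρ : E → ℝ => f.outflow i (restrict ρ i) :=
  exists_lipschitzWith_sum _ fun j _ => exists_lipschitzWith_flow f i j

theorem exists_lipschitzWith_velocity_apply (f : N.RoutingPolicy) (e : E) :
    ∃ K, LipschitzWith K fun ρ : E → ℝ => f.velocity ρ e := by
  obtain ⟨K, hK⟩ := exists_lipschitzWith_sum Finset.univ fun i (_ : i ∈ Finset.univ) =>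
    exists_lipschitzWith_flow f i (.inl e)
  obtain ⟨K', hK'⟩ := exists_lipschitzWith_outflow f (.inl e)
  exact ⟨K + K', hK.sub hK'⟩

theorem exists_lipschitzWith_velocity (f : N.RoutingPolicy) : ∃ K, LipschitzWith K f.velocity := by
  choose K hK using exists_lipschitzWith_velocity_apply f
  refine ⟨∑ e, K e, LipschitzWith.of_dist_le_mul fun x y => ?_⟩
  refine (dist_pi_le_iff (by positivity)).2 fun e => ((hK e).dist_le_mul x y).trans ?_
  gcongr
  exact_mod_cast Finset.single_le_sum (f := K) (fun _ _ => zero_le) (Finset.mem_univ e)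

theorem exists_outflow_le (f : N.RoutingPolicy) (i : N.InLink) :
    ∃ C : ℝ, ∀ x ∈ N.localDomain i, f.outflow i x ≤ C := by
  rcases i with e | o
  · exact ⟨N.cap e, f.outflow_le e⟩
  · exact ⟨N.inflow o, fun x hx => (f.outflow_origin o x hx).le⟩

theorem exists_norm_velocity_le (f : N.RoutingPolicy) : ∃ L : ℝ≥0, ∀ ρ, ‖f.velocity ρ‖ ≤ L := by
  choose C hC using exists_outflow_le f
  have hC0 : ∀ i, 0 ≤ C i := fun i =>
    (outflow_nonneg (restrict_mem_localDomain 0 i)).trans (hC i _ (restrict_mem_localDomain 0 i))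
  refine ⟨NNReal.mk (∑ i, C i) (Finset.sum_nonneg fun i _ => hC0 i), fun ρ => ?_⟩
  rw [NNReal.coe_mk, pi_norm_le_iff_of_nonneg (Finset.sum_nonneg fun i _ => hC0 i)]
  intro e
  have h1 : ∑ i, f.flow i (restrict ρ i) (.inl e) ≤ ∑ i, C i := Finset.sum_le_sum fun i _ =>
    (flow_le_outflow (restrict_mem_localDomain ρ i) _).trans (hC i _ (restrict_mem_localDomain ρ i))
  have h2 : 0 ≤ ∑ i, f.flow i (restrict ρ i) (.inl e) := Finset.sum_nonneg fun i _ =>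
    f.flow_nonneg i _ (restrict_mem_localDomain ρ i) _
  have h3 : f.outflow (.inl e) (restrict ρ (.inl e)) ≤ ∑ i, C i :=
    (hC (.inl e) _ (restrict_mem_localDomain ρ _)).trans
      (Finset.single_le_sum (f := C) (fun i _ => hC0 i) (Finset.mem_univ _))
  have h4 : 0 ≤ f.outflow (.inl e) (restrict ρ (.inl e)) :=
    outflow_nonneg (restrict_mem_localDomain ρ _)
  rw [Real.norm_eq_abs, abs_le, velocity]
  constructor <;> linarith

open Classical in
theorem velocity_eq_sum_filter (f : N.RoutingPolicy) (ρ : E → ℝ) (e : E) :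
    f.velocity ρ e = ∑ i with N.head i = N.src e, f.flow i (restrict ρ i) (.inl e) -
      f.outflow (.inl e) (restrict ρ (.inl e)) := by
  rw [velocity, Finset.sum_filter]
  congr 1
  refine Finset.sum_congr rfl fun i _ => ?_
  split_ifs with h
  · rfl
  · exact f.flow_eq_zero i _ (restrict_mem_localDomain ρ i) _ (Ne.symm h)

/-- Makes the constant 0 a subsolution, which keeps solutions nonnegative. -/
theorem velocity_zero_nonneg (f : N.RoutingPolicy) (e : E) : 0 ≤ f.velocity 0 e := by
  have : f.outflow (.inl e) (restrict (0 : E → ℝ) (.inl e)) = 0 :=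
    outflow_localize_of_eq_zero (X := fun _ => ENNReal.ofReal 0)
      (restrict_mem_localDomain (0 : E → ℝ) (.inl e)) ENNReal.ofReal_zero
  rw [velocity, this, sub_zero]
  exact Finset.sum_nonneg fun i _ => f.flow_nonneg i _ (restrict_mem_localDomain _ i) _

open Classical in
/-- Conservation of mass on the links that leave a set of non-destination nodes. -/
theorem sum_velocity_linksFrom (f : N.RoutingPolicy) (ρ : E → ℝ) {U : Finset V}
    (hU : ∀ v ∈ U, ¬ N.IsDestination v) :
    ∑ e ∈ N.linksFrom U, f.velocity ρ e = ∑ v ∈ U, N.inflow v +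
      ∑ e ∈ N.inBoundary U, f.outflow (.inl e) (restrict ρ (.inl e)) -
      ∑ e ∈ N.outBoundary U, f.outflow (.inl e) (restrict ρ (.inl e)) := by
  set out : N.InLink → ℝ := fun i => f.outflow i (restrict ρ i) with hout
  have h1 : ∀ i : N.InLink, ∑ e ∈ N.linksFrom U, f.flow i (restrict ρ i) (.inl e) =
      if N.head i ∈ U then out i else 0 := by
    intro i
    have hi := restrict_mem_localDomain ρ i
    rw [linksFrom, Finset.sum_filter]
    split_ifs with h
    · rw [hout]
      simp only [outflow, Fintype.sum_sum_type]
      rw [Finset.sum_eq_zero (s := Finset.univ (α := {v // N.IsDestination v})), add_zero]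
      · refine Finset.sum_congr rfl fun e _ => ?_
        split_ifs with he
        · rfl
        · exact (f.flow_eq_zero i _ hi _ fun h' => he (by rw [← h'] at h; exact h)).symm
      · exact fun d _ => f.flow_eq_zero i _ hi _ fun h' => hU _ h (h' ▸ d.2)
    · refine Finset.sum_eq_zero fun e _ => ?_
      split_ifs with he
      · exact f.flow_eq_zero i _ hi _ fun h' => h (by rw [← h']; exact he)
      · rfl
  have h2 : ∑ o : {v // N.IsOrigin v}, (if N.head (.inr o) ∈ U then out (.inr o) else 0) =
      ∑ v ∈ U, N.inflow v := by
    have : ∀ o : {v // N.IsOrigin v}, (if N.head (.inr o) ∈ U then out (.inr o) else 0) =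
        (fun v => if v ∈ U then N.inflow v else 0) o.1 := fun o => by
      have := f.outflow_origin o _ (restrict_mem_localDomain ρ (.inr o))
      simp only [head, hout, outflow, this]
    rw [Finset.sum_congr rfl fun o _ => this o, ← Finset.sum_subtype
      (Finset.univ.filter N.IsOrigin) (by simp) fun v => if v ∈ U then N.inflow v else 0,
      ← Finset.sum_filter, Finset.filter_filter]
    refine Finset.sum_subset (fun v hv => (Finset.mem_filter.1 hv).2.2) fun v hv hv' => ?_
    have : ¬ N.IsOrigin v := fun h => hv' (by simp [h, hv])
    exact le_antisymm (not_lt.1 this) (N.inflow_nonneg v)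
  simp only [velocity, Finset.sum_sub_distrib]
  rw [Finset.sum_comm, Finset.sum_congr rfl fun i _ => h1 i, Fintype.sum_sum_type, h2]
  simp only [linksFrom, inBoundary, outBoundary, Finset.sum_filter]
  -- Links with head in `U` are those with tail in `U`, plus the incoming, minus the outgoing
  -- boundary. The terms with tail in `U` cancel against the outflows being subtracted.
  have : ∀ e : E, (if N.head (.inl e) ∈ U then out (.inl e) else 0) =
      (if N.src e ∈ U then out (.inl e) else 0) +
      (if N.src e ∉ U ∧ N.tgt e ∈ U then out (.inl e) else 0) -
      (if N.src e ∈ U ∧ N.tgt e ∉ U then out (.inl e) else 0) := fun e => by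
    by_cases h : N.src e ∈ U <;> by_cases h' : N.tgt e ∈ U <;> simp [head, h, h']
  rw [Finset.sum_congr rfl fun e _ => this e]
  simp only [Finset.sum_add_distrib, Finset.sum_sub_distrib]
  simp only [hout]
  ring

end Velocity

end RoutingPolicy

end FlowNetwork

/-! ### The minimal trajectory, its limit and its saturated set -/

namespace FlowNetwork

variable {V E : Type*} [Fintype V] [Fintype E] {N : FlowNetwork V E}

namespace RoutingPolicy

variable {f : N.RoutingPolicy}

theorem IsSolution.hasDerivWithinAt {ρ₀ : E → ℝ} {ρ : ℝ → E → ℝ} (h : f.IsSolution ∞ ρ₀ ρ)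
    (e : E) (t : ℝ) (ht : 0 ≤ t) :
    HasDerivWithinAt (fun s => ρ s e) (f.velocity (ρ t) e) (Set.Ici 0) t :=
  h.deriv t ht ENNReal.ofReal_lt_top e

theorem IsSolution.apply_nonneg {ρ₀ : E → ℝ} {ρ : ℝ → E → ℝ} (h : f.IsSolution ∞ ρ₀ ρ)
    (e : E) {t : ℝ} (ht : 0 ≤ t) : 0 ≤ ρ t e :=
  h.nonneg t ht ENNReal.ofReal_lt_top e

theorem IsSolution.le (hf : f.IsStronglyMonotone) {T T' : ℝ≥0∞} {ρ₀ ρ₀' : E → ℝ}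
    {ρ ρ' : ℝ → E → ℝ} (h : f.IsSolution T ρ₀ ρ) (h' : f.IsSolution T' ρ₀' ρ') (h0 : ρ₀ ≤ ρ₀')
    {t : ℝ} (ht : 0 ≤ t) (htT : ENNReal.ofReal t < T) (htT' : ENNReal.ofReal t < T') :
    ρ t ≤ ρ' t := by
  obtain ⟨K, hK⟩ := exists_lipschitzWith_velocity f
  refine (isCooperative_velocity hf).le_of_subsolution_of_supersolution hK (T := t)
    (fun s hs => h.deriv s hs.1 ((ENNReal.ofReal_le_ofReal hs.2).trans_lt htT))
    (fun s hs => h'.deriv s hs.1 ((ENNReal.ofReal_le_ofReal hs.2).trans_lt htT'))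
    (fun _ _ _ => le_rfl) (fun _ _ _ => le_rfl) ?_ t ⟨ht, le_rfl⟩
  rwa [h.init, h'.init]

theorem exists_isSolution (hf : f.IsStronglyMonotone) {ρ₀ : E → ℝ} (h0 : 0 ≤ ρ₀) :
    ∃ ρ, f.IsSolution ∞ ρ₀ ρ := by
  obtain ⟨K, hK⟩ := exists_lipschitzWith_velocity f
  obtain ⟨L, hL⟩ := exists_norm_velocity_le f
  obtain ⟨ρ, hρ0, hρ⟩ := exists_forall_hasDerivWithinAt_of_lipschitzWith hK hL ρ₀
  have hd : ∀ t, 0 ≤ t → ∀ e,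
      HasDerivWithinAt (fun s => ρ s e) (f.velocity (ρ t) e) (Set.Ici 0) t :=
    fun t ht e => hasDerivWithinAt_pi.1 (hρ t ht) e
  refine ⟨ρ, hρ0, fun t ht _ => ?_, fun t ht _ => hd t ht⟩
  exact (isCooperative_velocity hf).le_of_subsolution_of_supersolution hK (T := t)
    (x := fun _ => 0) (x' := fun _ => 0) (fun s _ e => hasDerivWithinAt_const s _ (0 : ℝ))
    (fun s hs => hd s hs.1) (fun _ _ e => velocity_zero_nonneg f e) (fun _ _ _ => le_rfl)
    (by rwa [hρ0]) t ⟨ht, le_rfl⟩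

theorem IsSolution.shift {ρ₀ : E → ℝ} {ρ : ℝ → E → ℝ} (h : f.IsSolution ∞ ρ₀ ρ) {s : ℝ}
    (hs : 0 ≤ s) : f.IsSolution ∞ (ρ s) (fun t => ρ (s + t)) where
  init := by simp
  nonneg t ht _ e := h.apply_nonneg e (by linarith)
  deriv t ht _ e := by
    have h1 := h.hasDerivWithinAt e (s + t) (by linarith)
    have h2 : HasDerivWithinAt (fun t => s + t) 1 (Set.Ici 0) t :=
      ((hasDerivAt_id t).const_add s).hasDerivWithinAt
    simpa [Function.comp_def] using
      h1.comp t h2 fun r hr => (add_nonneg hs hr : (0 : ℝ) ≤ s + r)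

/-- The velocity is bounded, so trajectories are Lipschitz in time. This supplies the hypothesis of
Barbalat's lemma. -/
theorem IsSolution.exists_lipschitzOnWith_comp {ρ₀ : E → ℝ} {ρ : ℝ → E → ℝ}
    (h : f.IsSolution ∞ ρ₀ ρ) {G : (E → ℝ) → ℝ} (hG : ∃ K, LipschitzWith K G) :
    ∃ K, LipschitzOnWith K (fun t => G (ρ t)) (Set.Ici 0) := by
  obtain ⟨L, hL⟩ := exists_norm_velocity_le f
  obtain ⟨K, hK⟩ := hG
  have h1 : LipschitzOnWith L ρ (Set.Ici 0) :=
    (convex_Ici 0).lipschitzOnWith_of_nnnorm_hasDerivWithin_le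
      (fun t ht => hasDerivWithinAt_pi.2 fun e => h.hasDerivWithinAt e t ht) fun t _ => hL _
  exact ⟨K * L, hK.comp_lipschitzOnWith h1⟩

theorem IsSolution.tendsto_velocity_zero {ρ₀ : E → ℝ} {ρ : ℝ → E → ℝ}
    (h : f.IsSolution ∞ ρ₀ ρ) {e : E} {X : ℝ≥0∞} (hX : X ≠ ∞)
    (hlim : Tendsto (fun t => ENNReal.ofReal (ρ t e)) atTop (𝓝 X)) :
    Tendsto (fun t => f.velocity (ρ t) e) atTop (𝓝 0) := by
  obtain ⟨K, hK⟩ := h.exists_lipschitzOnWith_comp (exists_lipschitzWith_velocity_apply f e)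
  refine tendsto_deriv_zero_of_tendsto (h.hasDerivWithinAt e) hK (c := X.toReal) ?_
  refine ((ENNReal.tendsto_toReal hX).comp hlim).congr' ?_
  filter_upwards [eventually_ge_atTop 0] with t ht
  exact ENNReal.toReal_ofReal (h.apply_nonneg e ht)

/-- `x` is the trajectory that starts from the empty network, and `X` is its limit. -/
structure IsMinimalLimit (f : N.RoutingPolicy) (x : ℝ → E → ℝ) (X : E → ℝ≥0∞) : Prop where
  sol : f.IsSolution ∞ 0 x
  lim : ∀ e, Tendsto (fun t => ENNReal.ofReal (x t e)) atTop (𝓝 (X e))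

/-- The trajectory shifted by `t - s` starts above 0, hence stays above the unshifted one. -/
theorem IsSolution.mono_of_zero (hf : f.IsStronglyMonotone) {x : ℝ → E → ℝ}
    (h : f.IsSolution ∞ 0 x) {s t : ℝ} (hs : 0 ≤ s) (hst : s ≤ t) : x s ≤ x t := by
  have := h.le hf (h.shift (sub_nonneg.2 hst)) (fun e => h.apply_nonneg e (sub_nonneg.2 hst)) hs
    ENNReal.ofReal_lt_top ENNReal.ofReal_lt_top
  simpa using this

theorem exists_isMinimalLimit (hf : f.IsStronglyMonotone) : ∃ x X, f.IsMinimalLimit x X := by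
  obtain ⟨x, hx⟩ := exists_isSolution hf le_rfl
  refine ⟨x, fun e => ⨆ t, ENNReal.ofReal (x (max t 0) e), hx, fun e => ?_⟩
  have hm : Monotone fun t => ENNReal.ofReal (x (max t 0) e) := fun s t hst =>
    ENNReal.ofReal_le_ofReal
      (hx.mono_of_zero hf (le_max_right _ _) (max_le_max_right 0 hst) e)
  refine (tendsto_atTop_iSup hm).congr' ?_
  filter_upwards [eventually_ge_atTop 0] with t ht
  rw [max_eq_left ht]

open Classical in
/-- The nodes, other than destinations, all of whose outgoing links are congested. -/
def saturatedSet (N : FlowNetwork V E) (X : E → ℝ≥0∞) : Finset V :=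
  Finset.univ.filter fun v => ¬ N.IsDestination v ∧ ∀ e, N.src e = v → X e = ∞

theorem mem_saturatedSet {X : E → ℝ≥0∞} {v : V} :
    v ∈ saturatedSet N X ↔ ¬ N.IsDestination v ∧ ∀ e, N.src e = v → X e = ∞ := by
  simp [saturatedSet]

theorem isDestination_or_exists_of_notMem_saturatedSet {X : E → ℝ≥0∞} {v : V}
    (hv : v ∉ saturatedSet N X) : N.IsDestination v ∨ ∃ e, N.src e = v ∧ X e ≠ ∞ := by
  by_contra! h
  exact hv (mem_saturatedSet.2 h)

theorem localize_mem_of_notMem_saturatedSet {X : E → ℝ≥0∞} {i : N.InLink}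
    (hi : N.head i ∉ saturatedSet N X) : localize X i ∈ N.localDomain i :=
  localize_mem_localDomain.2 ((isDestination_or_exists_of_notMem_saturatedSet hi).imp_right
    fun ⟨k, hk, h⟩ => ⟨k, .inl hk, h⟩)

open Classical in
/-- The limit of the outflow of a link along the minimal trajectory. -/
def limitOutflow (f : N.RoutingPolicy) (X : E → ℝ≥0∞) (e : E) : ℝ :=
  if N.tgt e ∈ saturatedSet N X then 0 else f.outflow (.inl e) (localize X (.inl e))

open Classical in
/-- The limit of the inflow of a link along the minimal trajectory. -/
def limitInflow (f : N.RoutingPolicy) (X : E → ℝ≥0∞) (e : E) : ℝ :=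
  ∑ i with N.head i = N.src e, f.flow i (localize X i) (.inl e)

theorem limitInflow_eq_zero {X : E → ℝ≥0∞} {e : E} (hs : N.src e ∉ saturatedSet N X)
    (he : X e = ∞) : f.limitInflow X e = 0 := by
  classical
  refine Finset.sum_eq_zero fun i hi => ?_
  have hi' := (Finset.mem_filter.1 hi).2
  exact flow_localize_of_eq_top (localize_mem_of_notMem_saturatedSet (hi' ▸ hs)) hi'.symm he

theorem limitOutflow_eq_cap {X : E → ℝ≥0∞} {e : E} (hs : N.src e ∈ saturatedSet N X)
    (ht : N.tgt e ∉ saturatedSet N X) : f.limitOutflow X e = N.cap e := by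
  rw [limitOutflow, if_neg ht]
  exact outflow_localize_of_eq_top (localize_mem_of_notMem_saturatedSet (i := .inl e) ht)
    ((mem_saturatedSet.1 hs).2 e rfl)

theorem limitOutflow_eq_zero {X : E → ℝ≥0∞} {e : E} (ht : N.tgt e ∈ saturatedSet N X) :
    f.limitOutflow X e = 0 := if_pos ht

namespace IsMinimalLimit

variable {x : ℝ → E → ℝ} {X : E → ℝ≥0∞}

theorem velocity_nonneg (h : f.IsMinimalLimit x X) (hf : f.IsStronglyMonotone) {t : ℝ}
    (ht : 0 ≤ t) (e : E) : 0 ≤ f.velocity (x t) e := by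
  have hm : MonotoneOn (fun s => x s e) (Set.Ici 0) := fun s hs r _ hsr =>
    h.sol.mono_of_zero hf hs hsr e
  have := hm.derivWithin_nonneg (x := t)
  rwa [(h.sol.hasDerivWithinAt e t ht).derivWithin (uniqueDiffOn_Ici 0 t ht)] at this

open Classical in
theorem tendsto_inflow (h : f.IsMinimalLimit x X) {e : E} (hs : N.src e ∉ saturatedSet N X) :
    Tendsto (fun t => ∑ i with N.head i = N.src e, f.flow i (restrict (x t) i) (.inl e)) atTop
      (𝓝 (f.limitInflow X e)) :=
  tendsto_finsetSum _ fun _ hi => tendsto_flow h.lim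
    (localize_mem_of_notMem_saturatedSet (((Finset.mem_filter.1 hi).2).symm ▸ hs)) _

/-- A congested link between unsaturated nodes would in the limit receive nothing and emit its
capacity, whereas velocities along the minimal trajectory are nonnegative. -/
theorem ne_top (h : f.IsMinimalLimit x X) (hf : f.IsStronglyMonotone) {e : E}
    (hs : N.src e ∉ saturatedSet N X) (ht : N.tgt e ∉ saturatedSet N X) : X e ≠ ∞ := by
  classical
  intro he
  have hd : localize X (.inl e) ∈ N.localDomain (.inl e) := localize_mem_of_notMem_saturatedSet ht
  have h1 := (h.tendsto_inflow hs).sub (tendsto_outflow (f := f) h.lim hd)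
  rw [limitInflow_eq_zero hs he, outflow_localize_of_eq_top hd he] at h1
  have h2 : 0 ≤ 0 - N.cap e := ge_of_tendsto h1 <| by
    filter_upwards [eventually_ge_atTop 0] with t ht
    rw [← velocity_eq_sum_filter]
    exact h.velocity_nonneg hf ht e
  linarith [N.cap_pos e]

theorem tendsto_outflow (h : f.IsMinimalLimit x X) (hf : f.IsStronglyMonotone) {e : E}
    (he : N.src e ∉ saturatedSet N X ∨ N.tgt e ∉ saturatedSet N X) :
    Tendsto (fun t => f.outflow (.inl e) (restrict (x t) (.inl e))) atTop
      (𝓝 (f.limitOutflow X e)) := by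
  classical
  by_cases ht : N.tgt e ∈ saturatedSet N X
  · have hs := he.resolve_right (not_not.2 ht)
    rw [limitOutflow, if_pos ht]
    -- If `X e = ∞`, the local limit is outside the domain and continuity says nothing. But the
    -- inflow tends to 0, and it dominates the outflow because the density increases.
    by_cases hX : X e = ∞
    · have h1 := h.tendsto_inflow hs
      rw [limitInflow_eq_zero hs hX] at h1
      refine tendsto_of_tendsto_of_tendsto_of_le_of_le' tendsto_const_nhds h1
        (Eventually.of_forall fun t => outflow_nonneg (restrict_mem_localDomain _ _)) ?_
      filter_upwards [eventually_ge_atTop 0] with t ht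
      have := h.velocity_nonneg hf ht e
      rwa [velocity_eq_sum_filter, sub_nonneg] at this
    · have hd : localize X (.inl e) ∈ N.localDomain (.inl e) :=
        localize_mem_localDomain.2 (.inr ⟨e, .inr rfl, hX⟩)
      rw [← outflow_localize_of_forall_eq_top (f := f) hd (mem_saturatedSet.1 ht).1
        (mem_saturatedSet.1 ht).2]
      exact RoutingPolicy.tendsto_outflow h.lim hd
  · rw [limitOutflow, if_neg ht]
    exact RoutingPolicy.tendsto_outflow h.lim (localize_mem_of_notMem_saturatedSet ht)

theorem tendsto_velocity (h : f.IsMinimalLimit x X) (hf : f.IsStronglyMonotone) {e : E}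
    (hs : N.src e ∉ saturatedSet N X) :
    Tendsto (fun t => f.velocity (x t) e) atTop (𝓝 0) := by
  classical
  by_cases hX : X e = ∞
  · have ht : N.tgt e ∈ saturatedSet N X := by
      by_contra ht
      exact h.ne_top hf hs ht hX
    have h1 := (h.tendsto_inflow hs).sub (h.tendsto_outflow hf (.inl hs))
    rw [limitInflow_eq_zero hs hX, limitOutflow_eq_zero ht, sub_zero] at h1
    exact h1.congr fun t => (velocity_eq_sum_filter f (x t) e).symm
  · exact h.sol.tendsto_velocity_zero hX (h.lim e)

theorem limitInflow_eq (h : f.IsMinimalLimit x X) (hf : f.IsStronglyMonotone) {e : E}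
    (hs : N.src e ∉ saturatedSet N X) : f.limitInflow X e = f.limitOutflow X e := by
  classical
  have h1 := (h.tendsto_inflow hs).sub (h.tendsto_outflow hf (.inl hs))
  have h2 := (h.tendsto_velocity hf hs).congr fun t => velocity_eq_sum_filter f (x t) e
  exact sub_eq_zero.1 (tendsto_nhds_unique h1 h2)

/-- An empty link has no outflow, so its limiting inflow, a sum of nonnegative flows, vanishes too.
-/
theorem flow_eq_zero_of_eq_zero (h : f.IsMinimalLimit x X) (hf : f.IsStronglyMonotone) {e : E}
    (he : X e = 0) {i : N.InLink} (hi : N.head i = N.src e) :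
    f.flow i (localize X i) (.inl e) = 0 := by
  classical
  have hs : N.src e ∉ saturatedSet N X := fun hs => by
    simpa [he] using (mem_saturatedSet.1 hs).2 e rfl
  have h0 : f.limitOutflow X e = 0 := by
    rw [limitOutflow]
    split_ifs with ht
    · rfl
    · exact outflow_localize_of_eq_zero (localize_mem_of_notMem_saturatedSet ht) he
  rw [← h.limitInflow_eq hf hs, limitInflow, Finset.sum_eq_zero_iff_of_nonneg] at h0
  · exact h0 i (by simp [hi])
  · intro i hi
    exact f.flow_nonneg i _
      (localize_mem_of_notMem_saturatedSet (((Finset.mem_filter.1 hi).2).symm ▸ hs)) _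

/-- In the limit no link is empty. -/
theorem ne_zero (h : f.IsMinimalLimit x X) (hf : f.IsStronglyMonotone) (hN : N.IsConnected)
    (e : E) : X e ≠ 0 := by
  classical
  -- Nonemptiness spreads along paths from the external world.
  have key : ∀ a : Option V, Relation.ReflTransGen N.AugAdj none a →
      ∀ v, a = some v → ∀ e, N.src e = v → X e ≠ 0 := by
    intro a ha
    induction ha with
    | refl => simp
    | @tail b c _ hbc ih =>
      rintro v rfl e rfl he
      have hs : N.src e ∉ saturatedSet N X := fun hs => by
        simpa [he] using (mem_saturatedSet.1 hs).2 e rfl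
      rcases b with _ | u
      · set i : N.InLink := .inr ⟨N.src e, hbc⟩
        have hd : localize X i ∈ N.localDomain i := localize_mem_of_notMem_saturatedSet hs
        -- A nonempty `k` beside the empty `e` would push flow into `e`. So all links here are empty
        -- and receive nothing, though the origin must send out its positive inflow.
        have hall : ∀ k, N.src k = N.src e → X k = 0 := by
          intro k hk
          by_contra hk0
          have hke : k ≠ e := fun hke => hk0 (hke ▸ he)
          have hle : Function.update X k 0 ≤ X := update_le_iff.2 ⟨zero_le, fun _ _ => le_rfl⟩
          have h1 := flow_lt hf (i := i) (j := .inl e) hle hd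
            (fun l hl => by
              obtain rfl := Sum.inl_injective hl
              simp [hke.symm, he])
            rfl (.inl hk) (by simpa using hke) (by simpa using pos_iff_ne_zero.2 hk0)
            (fun l hl => by simp [i] at hl)
          rw [h.flow_eq_zero_of_eq_zero hf he rfl] at h1
          exact h1.not_ge (f.flow_nonneg i _ (localize_mem_localDomain_of_le hle hd) _)
        have h1 := f.outflow_origin ⟨N.src e, hbc⟩ _ hd
        rw [Finset.sum_eq_zero] at h1
        · exact absurd h1 hbc.ne
        · intro j _
          by_cases hj : N.tail j = N.head i
          · rcases j with k | d
            · exact h.flow_eq_zero_of_eq_zero hf (hall k hj) hj.symm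
            · exact absurd d.2 ((show d.1 = N.src e from hj) ▸ not_isDestination_src e)
          · exact f.flow_eq_zero i _ hd j hj
      · obtain ⟨k, rfl, hk⟩ := hbc
        have hk0 := ih _ rfl k rfl
        have hd : localize X (.inl k) ∈ N.localDomain (.inl k) :=
          localize_mem_of_notMem_saturatedSet (i := .inl k) (by rw [← hk] at hs; exact hs)
        have h1 := flow_pos hf hd (j := .inl e)
          (fun l hl => by
            obtain rfl := Sum.inl_injective hl
            simp [he]) hk.symm hk0
        exact h1.ne' (h.flow_eq_zero_of_eq_zero hf he hk)
  exact key _ (hN.2 none (some (N.src e))) _ rfl e rfl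

theorem limitOutflow_pos (h : f.IsMinimalLimit x X) (hf : f.IsStronglyMonotone)
    (hN : N.IsConnected) {e : E} (ht : N.tgt e ∉ saturatedSet N X) : 0 < f.limitOutflow X e := by
  rw [limitOutflow, if_neg ht]
  exact outflow_pos hf (h.ne_zero hf hN e) (isDestination_or_exists_of_notMem_saturatedSet ht)

theorem limitOutflow_lt_cap (h : f.IsMinimalLimit x X) (hf : f.IsStronglyMonotone) {e : E}
    (hs : N.src e ∉ saturatedSet N X) (ht : N.tgt e ∉ saturatedSet N X) :
    f.limitOutflow X e < N.cap e := by
  rw [limitOutflow, if_neg ht]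
  exact outflow_lt_cap hf (h.ne_top hf hs ht) (isDestination_or_exists_of_notMem_saturatedSet ht)

/-- Flow balance of the limit outside the saturated set. -/
theorem balance (h : f.IsMinimalLimit x X) (hf : f.IsStronglyMonotone) {B : Finset V}
    (hB : ∀ v ∈ B, ¬ N.IsDestination v) (hBX : ∀ v ∈ B, v ∉ saturatedSet N X) :
    ∑ v ∈ B, N.inflow v + ∑ e ∈ N.inBoundary B, f.limitOutflow X e =
      ∑ e ∈ N.outBoundary B, f.limitOutflow X e := by
  have h1 : Tendsto (fun t => ∑ e ∈ N.linksFrom B, f.velocity (x t) e) atTop (𝓝 0) := by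
    rw [← Finset.sum_const_zero (s := N.linksFrom B)]
    exact tendsto_finsetSum _ fun e he => h.tendsto_velocity hf (hBX _ (mem_linksFrom.1 he))
  have h2 := ((tendsto_const_nhds (x := ∑ v ∈ B, N.inflow v)).add
    (tendsto_finsetSum (N.inBoundary B) fun e he =>
      h.tendsto_outflow hf (.inr (hBX _ (mem_inBoundary.1 he).2)))).sub
    (tendsto_finsetSum (N.outBoundary B) fun e he =>
      h.tendsto_outflow hf (.inl (hBX _ (mem_outBoundary.1 he).1)))
  have h3 := h1.congr fun t => sum_velocity_linksFrom f (x t) hB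
  exact sub_eq_zero.1 (tendsto_nhds_unique h2 h3)

/-- Flow balance of the limit inside the saturated set. -/
theorem saturated_balance (h : f.IsMinimalLimit x X) (hf : f.IsStronglyMonotone) {R : Finset V}
    (hR : R ⊆ saturatedSet N X) [DecidableEq V] :
    0 ≤ ∑ v ∈ R, N.inflow v +
      ∑ e ∈ N.inBoundary R, (if N.src e ∈ saturatedSet N X then N.cap e else 0) -
      ∑ e ∈ N.outBoundary R, (if N.tgt e ∈ saturatedSet N X then 0 else N.cap e) := by
  -- Continuity gives no limit of the outflow between two saturated nodes, so it is replaced by its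
  -- bound: capacity when entering `R`, 0 when leaving.
  have h2 := ((tendsto_const_nhds (x := ∑ v ∈ R, N.inflow v)).add
    (tendsto_finsetSum (N.inBoundary R) (f := fun e t =>
      if N.src e ∈ saturatedSet N X then N.cap e
        else f.outflow (.inl e) (restrict (x t) (.inl e)))
      (a := fun e => if N.src e ∈ saturatedSet N X then N.cap e else 0) (x := atTop)
      fun e he => ?_)).sub
    (tendsto_finsetSum (N.outBoundary R) (f := fun e t =>
      if N.tgt e ∈ saturatedSet N X then 0
        else f.outflow (.inl e) (restrict (x t) (.inl e)))
      (a := fun e => if N.tgt e ∈ saturatedSet N X then 0 else N.cap e) (x := atTop)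
      fun e he => ?_)
  · refine ge_of_tendsto h2 ?_
    filter_upwards [eventually_ge_atTop 0] with t ht
    have h3 := sum_velocity_linksFrom f (x t) (U := R) fun v hv => (mem_saturatedSet.1 (hR hv)).1
    have h4 : 0 ≤ ∑ e ∈ N.linksFrom R, f.velocity (x t) e :=
      Finset.sum_nonneg fun e _ => h.velocity_nonneg hf ht e
    rw [h3] at h4
    refine h4.trans (sub_le_sub (add_le_add le_rfl (Finset.sum_le_sum fun e _ => ?_))
      (Finset.sum_le_sum fun e _ => ?_))
    · split_ifs
      · exact f.outflow_le e _ (restrict_mem_localDomain _ _)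
      · exact le_rfl
    · split_ifs
      · exact outflow_nonneg (restrict_mem_localDomain _ _)
      · exact le_rfl
  · split_ifs with hs
    · exact tendsto_const_nhds
    · have := h.tendsto_outflow hf (.inl hs)
      rwa [limitOutflow_eq_zero (hR (mem_inBoundary.1 he).2)] at this
  · split_ifs with ht
    · exact tendsto_const_nhds
    · have := h.tendsto_outflow hf (.inr ht)
      rwa [limitOutflow_eq_cap (hR (mem_outBoundary.1 he).1) ht] at this

/-- Every set of unsaturated nodes has a link to other unsaturated nodes. -/
theorem exists_link (h : f.IsMinimalLimit x X) (hf : f.IsStronglyMonotone) (hN : N.IsConnected)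
    {B : Finset V} (hB : ∀ v ∈ B, ¬ N.IsDestination v) (hBX : ∀ v ∈ B, v ∉ saturatedSet N X)
    (hne : B.Nonempty) : ∃ e, N.src e ∈ B ∧ N.tgt e ∉ B ∧ N.tgt e ∉ saturatedSet N X := by
  -- Otherwise nothing leaves `B` in the limit. By balance nothing enters it either, so `B` has no
  -- inflow and no incoming links, and cannot be reached from the external world.
  by_contra! hcon
  have h1 := h.balance hf hB hBX
  rw [Finset.sum_eq_zero (s := N.outBoundary B) fun e he =>
    limitOutflow_eq_zero (hcon e (mem_outBoundary.1 he).1 (mem_outBoundary.1 he).2)] at h1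
  have hpos : ∀ e ∈ N.inBoundary B, 0 < f.limitOutflow X e := fun e he =>
    h.limitOutflow_pos hf hN (hBX _ (mem_inBoundary.1 he).2)
  have h2 : 0 ≤ ∑ e ∈ N.inBoundary B, f.limitOutflow X e :=
    Finset.sum_nonneg fun e he => (hpos e he).le
  have h3 : 0 ≤ ∑ v ∈ B, N.inflow v := Finset.sum_nonneg fun v _ => N.inflow_nonneg v
  have h4 := (Finset.sum_eq_zero_iff_of_nonneg fun e he => (hpos e he).le).1
    (show ∑ e ∈ N.inBoundary B, f.limitOutflow X e = 0 by linarith)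
  have h5 := (Finset.sum_eq_zero_iff_of_nonneg fun v _ => N.inflow_nonneg v).1
    (show ∑ v ∈ B, N.inflow v = 0 by linarith)
  have key : ∀ a : Option V, Relation.ReflTransGen N.AugAdj none a →
      ∀ v, a = some v → v ∉ B := by
    intro a ha
    induction ha with
    | refl => simp
    | @tail b c _ hbc ih =>
      rintro v rfl hv
      rcases b with _ | u
      · exact absurd (h5 v hv) (ne_of_gt hbc)
      · obtain ⟨e, rfl, rfl⟩ := hbc
        have he : e ∈ N.inBoundary B := mem_inBoundary.2 ⟨ih _ rfl, hv⟩
        exact (hpos e he).ne' (h4 e he)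
  obtain ⟨v, hv⟩ := hne
  exact key _ (hN.2 none (some v)) v rfl hv

/-- Eliminating the inflows by the balance of `U \ W` and the inequality for `W \ U` bounds the
difference of excesses by a sum over links. Each term is nonpositive, whichever of `U`, `W` contain
its endpoints, and it is negative on a link from `U \ W` to outside `U ∪ W`, where the limiting
outflow is below capacity. -/
theorem excess_le_and_lt (h : f.IsMinimalLimit x X) (hf : f.IsStronglyMonotone)
    (hN : N.IsConnected) {U : Finset V} (hU : ∀ v ∈ U, ¬ N.IsDestination v) :
    N.excess U ≤ N.excess (saturatedSet N X) ∧
      (¬ U ⊆ saturatedSet N X → N.excess U < N.excess (saturatedSet N X)) := by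
  classical
  set W := saturatedSet N X with hW
  have hB : ∀ v ∈ U \ W, ¬ N.IsDestination v := fun v hv => hU v (Finset.mem_sdiff.1 hv).1
  have hBX : ∀ v ∈ U \ W, v ∉ W := fun v hv => (Finset.mem_sdiff.1 hv).2
  have h1 := h.balance hf hB hBX
  have h2 := h.saturated_balance hf (R := W \ U) Finset.sdiff_subset
  have h3 : ∑ v ∈ W, N.inflow v - ∑ v ∈ U, N.inflow v =
      ∑ v ∈ W \ U, N.inflow v - ∑ v ∈ U \ W, N.inflow v :=
    (Finset.sum_sdiff_sub_sum_sdiff ..).symm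
  let g : E → ℝ := fun e =>
    (if N.src e ∈ W ∧ N.tgt e ∉ W then N.cap e else 0)
    - (if N.src e ∈ U ∧ N.tgt e ∉ U then N.cap e else 0)
    + (if N.src e ∉ W \ U ∧ N.tgt e ∈ W \ U then if N.src e ∈ W then N.cap e else 0 else 0)
    - (if N.src e ∈ W \ U ∧ N.tgt e ∉ W \ U then if N.tgt e ∈ W then 0 else N.cap e else 0)
    - (if N.src e ∉ U \ W ∧ N.tgt e ∈ U \ W then f.limitOutflow X e else 0)
    + (if N.src e ∈ U \ W ∧ N.tgt e ∉ U \ W then f.limitOutflow X e else 0)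
  have hterm : ∀ e : E, g e ≤ 0 ∧
      (N.src e ∈ U \ W ∧ N.tgt e ∉ U \ W ∧ N.tgt e ∉ W → g e < 0) := by
    intro e
    simp only [g]
    have hc := N.cap_pos e
    by_cases hs : N.src e ∈ W <;> by_cases ht : N.tgt e ∈ W
    · by_cases hs' : N.src e ∈ U <;> by_cases ht' : N.tgt e ∈ U <;>
        simp [hs, ht, hs', ht']
    · have h4 := limitOutflow_eq_cap (f := f) hs ht
      by_cases hs' : N.src e ∈ U <;> by_cases ht' : N.tgt e ∈ U <;>
        simp [hs, ht, hs', ht', hc.le, h4]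
    · have h4 := limitOutflow_eq_zero (f := f) ht
      by_cases hs' : N.src e ∈ U <;> by_cases ht' : N.tgt e ∈ U <;>
        simp [hs, ht, hs', ht', hc.le, h4]
    · have h4 := h.limitOutflow_lt_cap hf hs ht
      have h5 := h.limitOutflow_pos hf hN ht
      by_cases hs' : N.src e ∈ U <;> by_cases ht' : N.tgt e ∈ U <;>
        simp [hs, ht, hs', ht', h4, h4.le, h5.le]
  have hsum : N.excess U - N.excess W ≤ ∑ e, g e := by
    simp only [g]
    simp only [Finset.sum_add_distrib, Finset.sum_sub_distrib, ← Finset.sum_filter]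
    simp only [excess]
    have e1 : ∀ S : Finset V, N.outBoundary S =
      Finset.univ.filter (fun e => N.src e ∈ S ∧ N.tgt e ∉ S) := fun S => by ext; simp [outBoundary]
    have e2 : ∀ S : Finset V, N.inBoundary S =
      Finset.univ.filter (fun e => N.src e ∉ S ∧ N.tgt e ∈ S) := fun S => by ext; simp [inBoundary]
    simp only [← e1, ← e2]
    simp only [Finset.sum_filter] at *
    linarith
  constructor
  · have := Finset.sum_nonpos fun e (_ : e ∈ Finset.univ) => (hterm e).1
    linarith
  · intro hsub
    obtain ⟨e, he⟩ := h.exists_link hf hN hB hBX (by rwa [Finset.sdiff_nonempty])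
    have := Finset.sum_neg' (fun e (_ : e ∈ Finset.univ) => (hterm e).1)
      ⟨e, Finset.mem_univ e, (hterm e).2 he⟩
    linarith

/-- The saturated set is the union of the cuts of maximal excess. -/
theorem saturatedSet_eq (h : f.IsMinimalLimit x X) (hf : f.IsStronglyMonotone)
    (hN : N.IsConnected) (hmax : ∃ U, N.IsMaxCut U ∧ 0 ≤ N.excess U) :
    saturatedSet N X = N.criticalSet := by
  obtain ⟨U, hU, hU0⟩ := hmax
  have hsub : ∀ U', N.IsMaxCut U' → U' ⊆ saturatedSet N X := by
    intro U' hU'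
    by_contra hcon
    have h1 := (h.excess_le_and_lt hf hN hU'.1.2).2 hcon
    have h2 := hU'.2 U hU.1
    -- The empty set is not a cut; its excess 0 is ruled out by the nonnegativity of the maximum.
    by_cases hW : (saturatedSet N X).Nonempty
    · exact h1.not_ge (hU'.2 _ ⟨hW, fun v hv => (mem_saturatedSet.1 hv).1⟩)
    · rw [Finset.not_nonempty_iff_eq_empty.1 hW] at h1
      have : N.excess ∅ = 0 := by simp [excess, outBoundary]
      linarith
  have hW : N.IsMaxCut (saturatedSet N X) :=
    ⟨⟨hU.1.1.mono (hsub U hU), fun v hv => (mem_saturatedSet.1 hv).1⟩,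
      fun U' hU' => (h.excess_le_and_lt hf hN hU'.2).1⟩
  ext v
  simp only [criticalSet, Finset.mem_filter_univ]
  exact ⟨fun hv => ⟨_, hW, hv⟩, fun ⟨U', hU', hv⟩ => hsub U' hU' hv⟩

end IsMinimalLimit

end RoutingPolicy

end FlowNetwork

/-! ### Convergence of all trajectories to the minimal limit -/

namespace FlowNetwork

variable {V E : Type*} [Fintype V] {N : FlowNetwork V E}

open Classical in
/-- The non-destination nodes. -/
def innerNodes (N : FlowNetwork V E) : Finset V := Finset.univ.filter fun v => ¬ N.IsDestination v

theorem mem_innerNodes {v : V} : v ∈ innerNodes N ↔ ¬ N.IsDestination v := by simp [innerNodes]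

variable [Fintype E]

namespace RoutingPolicy

variable {f : N.RoutingPolicy}

theorem mem_outBoundary_innerNodes {e : E} :
    e ∈ N.outBoundary (innerNodes N) ↔ N.IsDestination (N.tgt e) := by
  rw [mem_outBoundary, mem_innerNodes, mem_innerNodes, not_not]
  exact and_iff_right (not_isDestination_src e)

/-- Mass leaves the network only through the links into destinations. -/
theorem sum_velocity (f : N.RoutingPolicy) (ρ : E → ℝ) :
    ∑ e, f.velocity ρ e = ∑ v ∈ innerNodes N, N.inflow v -
      ∑ e ∈ N.outBoundary (innerNodes N), f.outflow (.inl e) (restrict ρ (.inl e)) := by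
  have h1 : N.linksFrom (innerNodes N) = Finset.univ :=
    Finset.eq_univ_of_forall fun e => mem_linksFrom.2 (mem_innerNodes.2 (not_isDestination_src e))
  have h2 : N.inBoundary (innerNodes N) = ∅ :=
    Finset.eq_empty_of_forall_notMem fun e he =>
      (mem_inBoundary.1 he).1 (mem_innerNodes.2 (not_isDestination_src e))
  have h3 := sum_velocity_linksFrom f ρ (U := innerNodes N) fun v hv => mem_innerNodes.1 hv
  rwa [h1, h2, Finset.sum_empty, add_zero] at h3

namespace IsSolution

variable {x y : ℝ → E → ℝ} {ρ₀ ρ₁ : E → ℝ}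

theorem hasDerivWithinAt_sum_sub (hx : f.IsSolution ∞ ρ₀ x) (hy : f.IsSolution ∞ ρ₁ y) (t : ℝ)
    (ht : 0 ≤ t) : HasDerivWithinAt (fun s => ∑ e, (y s e - x s e))
      (∑ e ∈ N.outBoundary (innerNodes N), (f.outflow (.inl e) (restrict (x t) (.inl e)) -
        f.outflow (.inl e) (restrict (y t) (.inl e)))) (Set.Ici 0) t := by
  have h1 : HasDerivWithinAt (fun s => ∑ e, (y s e - x s e))
      (∑ e, (f.velocity (y t) e - f.velocity (x t) e)) (Set.Ici 0) t :=
    HasDerivWithinAt.fun_sum fun e _ =>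
      (hy.hasDerivWithinAt e t ht).sub (hx.hasDerivWithinAt e t ht)
  convert h1 using 1
  rw [Finset.sum_sub_distrib, Finset.sum_sub_distrib, sum_velocity, sum_velocity]
  ring

/-- No network link lies downstream, so the outflow depends only on the link's own density. -/
theorem outflow_le_of_isDestination (hf : f.IsStronglyMonotone) (hx : f.IsSolution ∞ ρ₀ x)
    (hy : f.IsSolution ∞ ρ₁ y) (h0 : ρ₀ ≤ ρ₁) {t : ℝ} (ht : 0 ≤ t) {e : E}
    (he : N.IsDestination (N.tgt e)) :
    f.outflow (.inl e) (restrict (x t) (.inl e)) ≤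
      f.outflow (.inl e) (restrict (y t) (.inl e)) :=
  outflow_mono_self hf (fun k => ENNReal.ofReal_le_ofReal
    (hx.le hf hy h0 ht ENNReal.ofReal_lt_top ENNReal.ofReal_lt_top k))
    (restrict_mem_localDomain _ _) fun k hk => absurd hk (he k)

theorem sum_sub_antitoneOn (hf : f.IsStronglyMonotone) (hx : f.IsSolution ∞ ρ₀ x)
    (hy : f.IsSolution ∞ ρ₁ y) (h0 : ρ₀ ≤ ρ₁) :
    AntitoneOn (fun s => ∑ e, (y s e - x s e)) (Set.Ici 0) := by
  refine antitoneOn_of_hasDerivWithinAt_nonpos (convex_Ici 0)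
    (fun t ht => (hx.hasDerivWithinAt_sum_sub hy t ht).continuousWithinAt)
    (fun t ht => (hx.hasDerivWithinAt_sum_sub hy t (interior_subset ht)).mono interior_subset)
    fun t ht => Finset.sum_nonpos fun e he => sub_nonpos.2 ?_
  exact hx.outflow_le_of_isDestination hf hy h0 (interior_subset ht)
    (mem_outBoundary_innerNodes.1 he)

theorem sub_nonneg_of_le (hf : f.IsStronglyMonotone) (hx : f.IsSolution ∞ ρ₀ x)
    (hy : f.IsSolution ∞ ρ₁ y) (h0 : ρ₀ ≤ ρ₁) {t : ℝ} (ht : 0 ≤ t) (e : E) :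
    0 ≤ y t e - x t e :=
  sub_nonneg.2 (hx.le hf hy h0 ht ENNReal.ofReal_lt_top ENNReal.ofReal_lt_top e)

/-- The ℓ¹ distance is nonincreasing and nonnegative, so it converges and its derivative tends to 0.
That derivative is minus a sum of nonnegative differences, each of which must vanish in the limit.
-/
theorem tendsto_outflow_sub (hf : f.IsStronglyMonotone) (hx : f.IsSolution ∞ ρ₀ x)
    (hy : f.IsSolution ∞ ρ₁ y) (h0 : ρ₀ ≤ ρ₁) {e : E} (he : N.IsDestination (N.tgt e)) :
    Tendsto (fun t => f.outflow (.inl e) (restrict (y t) (.inl e)) -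
      f.outflow (.inl e) (restrict (x t) (.inl e))) atTop (𝓝 0) := by
  have hlim : ∃ c, Tendsto (fun s => ∑ e, (y s e - x s e)) atTop (𝓝 c) := by
    have ha : Antitone fun s : ℝ => ∑ e, (y (max s 0) e - x (max s 0) e) := fun s t hst =>
      hx.sum_sub_antitoneOn hf hy h0 (le_max_right s 0) (le_max_right t 0) (max_le_max_right 0 hst)
    refine ⟨_, (tendsto_atTop_ciInf ha ⟨0, ?_⟩).congr' ?_⟩
    · rintro _ ⟨s, rfl⟩
      exact Finset.sum_nonneg fun e _ => hx.sub_nonneg_of_le hf hy h0 (le_max_right s 0) e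
    · filter_upwards [eventually_ge_atTop 0] with t ht
      rw [max_eq_left ht]
  obtain ⟨c, hc⟩ := hlim
  have hlip : ∀ {ρ₀ : E → ℝ} {x : ℝ → E → ℝ}, f.IsSolution ∞ ρ₀ x → ∃ K, LipschitzOnWith K
      (fun t => ∑ e ∈ N.outBoundary (innerNodes N), f.outflow (.inl e) (restrict (x t) (.inl e)))
      (Set.Ici 0) := fun hx => hx.exists_lipschitzOnWith_comp <|
    exists_lipschitzWith_sum _ fun e _ => exists_lipschitzWith_outflow f (.inl e)
  obtain ⟨K, hK⟩ := hlip hx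
  obtain ⟨K', hK'⟩ := hlip hy
  have h1 := tendsto_deriv_zero_of_tendsto (hx.hasDerivWithinAt_sum_sub hy)
    (K := K + K') (by simpa only [Finset.sum_sub_distrib] using hK.sub hK') hc
  have h2 := h1.neg
  rw [neg_zero] at h2
  refine tendsto_of_tendsto_of_tendsto_of_le_of_le' tendsto_const_nhds h2 ?_ ?_
  · filter_upwards [eventually_ge_atTop 0] with t ht
    exact sub_nonneg.2 (hx.outflow_le_of_isDestination hf hy h0 ht he)
  · filter_upwards [eventually_ge_atTop 0] with t ht
    rw [← Finset.sum_neg_distrib]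
    simp only [neg_sub]
    exact Finset.single_le_sum (f := fun e => f.outflow (.inl e) (restrict (y t) (.inl e)) -
      f.outflow (.inl e) (restrict (x t) (.inl e)))
      (fun e he => sub_nonneg.2 (hx.outflow_le_of_isDestination hf hy h0 ht
        (mem_outBoundary_innerNodes.1 he))) (mem_outBoundary_innerNodes.2 he)

end IsSolution

namespace IsMinimalLimit

variable {x y : ℝ → E → ℝ} {X : E → ℝ≥0∞} {ρ₀ : E → ℝ}

theorem ofReal_le (h : f.IsMinimalLimit x X) (hf : f.IsStronglyMonotone)
    (hy : f.IsSolution ∞ ρ₀ y) (h0 : 0 ≤ ρ₀) (e : E) :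
    ∀ᶠ t in atTop, ENNReal.ofReal (x t e) ≤ ENNReal.ofReal (y t e) := by
  filter_upwards [eventually_ge_atTop 0] with t ht
  exact ENNReal.ofReal_le_ofReal
    (h.sol.le hf hy h0 ht ENNReal.ofReal_lt_top ENNReal.ofReal_lt_top e)

/-- Along every ultrafilter, all densities converge in `[0,∞]` to a limit above the minimal one. -/
theorem exists_le_of_ultrafilter (h : f.IsMinimalLimit x X) (hf : f.IsStronglyMonotone)
    (hy : f.IsSolution ∞ ρ₀ y) (h0 : 0 ≤ ρ₀) {F : Ultrafilter ℝ} (hF : ↑F ≤ (atTop : Filter ℝ)) :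
    ∃ Y : E → ℝ≥0∞, X ≤ Y ∧
      ∀ e, Tendsto (fun t => ENNReal.ofReal (y t e)) (F : Filter ℝ) (𝓝 (Y e)) := by
  have : ∀ e, ∃ Ye, Tendsto (fun t => ENNReal.ofReal (y t e)) (F : Filter ℝ) (𝓝 Ye) := fun e => by
    obtain ⟨Ye, -, hYe⟩ := isCompact_univ.ultrafilter_le_nhds
      (F.map fun t => ENNReal.ofReal (y t e)) (by simp)
    exact ⟨Ye, hYe⟩
  choose Y hY using this
  exact ⟨Y, fun e => le_of_tendsto_of_tendsto ((h.lim e).mono_left hF) (hY e)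
    ((h.ofReal_le hf hy h0 e).filter_mono hF), hY⟩

/-- Along any ultrafilter the limiting outflows agree, and the outflow is strictly increasing in the
density. -/
theorem tendsto_of_isDestination (h : f.IsMinimalLimit x X) (hf : f.IsStronglyMonotone)
    (hy : f.IsSolution ∞ ρ₀ y) (h0 : 0 ≤ ρ₀) {e : E} (he : N.IsDestination (N.tgt e)) :
    Tendsto (fun t => ENNReal.ofReal (y t e)) atTop (𝓝 (X e)) := by
  rw [tendsto_iff_ultrafilter]
  intro F hF
  obtain ⟨Y, hXY, hY⟩ := h.exists_le_of_ultrafilter hf hy h0 hF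
  have hd : ∀ Z, localize Z (.inl e) ∈ N.localDomain (.inl e) := fun Z => Or.inl he
  have h1 := (RoutingPolicy.tendsto_outflow (f := f) hY (hd Y)).sub
    ((RoutingPolicy.tendsto_outflow (f := f) h.lim (hd X)).mono_left hF)
  have h2 := tendsto_nhds_unique h1 ((h.sol.tendsto_outflow_sub hf hy h0 he).mono_left hF)
  have h3 : X e = Y e := by
    by_contra hne
    exact (outflow_lt_self hf hXY (hd Y) (fun k hk => absurd hk (he k))
      ((hXY e).lt_of_ne hne) (.inl he)).ne' (sub_eq_zero.1 h2)
  rw [h3]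
  exact hY e

/-- If the density of `k` converges to its minimal limit, which is finite, then so do those of the
other links that leave the tail of `k`, and of the links that point into it. -/
theorem tendsto_of_tendsto (h : f.IsMinimalLimit x X) (hf : f.IsStronglyMonotone)
    (hN : N.IsConnected) (hy : f.IsSolution ∞ ρ₀ y) (h0 : 0 ≤ ρ₀) {k : E} (hk : X k ≠ ∞)
    (hlim : Tendsto (fun t => ENNReal.ofReal (y t k)) atTop (𝓝 (X k))) {e : E}
    (he : N.src e = N.src k ∨ N.tgt e = N.src k) :
    Tendsto (fun t => ENNReal.ofReal (y t e)) atTop (𝓝 (X e)) := by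
  classical
  rw [tendsto_iff_ultrafilter]
  intro F hF
  obtain ⟨Y, hXY, hY⟩ := h.exists_le_of_ultrafilter hf hy h0 hF
  have hYk : Y k = X k := tendsto_nhds_unique (hY k) (hlim.mono_left hF)
  suffices h3 : X e = Y e by
    rw [h3]
    exact hY e
  by_cases hke : e = k
  · rw [hke, hYk]
  have hdi : ∀ {Z : E → ℝ≥0∞} {i : N.InLink}, Z k ≠ ∞ → N.head i = N.src k →
      localize Z i ∈ N.localDomain i := fun hZ hi =>
    localize_mem_localDomain.2 (.inr ⟨k, .inl hi.symm, hZ⟩)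
  have hdk : ∀ {Z : E → ℝ≥0∞}, Z k ≠ ∞ → localize Z (.inl k) ∈ N.localDomain (.inl k) :=
    fun hZ => localize_mem_localDomain.2 (.inr ⟨k, .inr rfl, hZ⟩)
  -- By Barbalat's lemma the limit states are in balance at `k`.
  have hlimit : ∀ {z : ℝ → E → ℝ} {Z : E → ℝ≥0∞} {ρ : E → ℝ}, f.IsSolution ∞ ρ z → Z k ≠ ∞ →
      Tendsto (fun t => ENNReal.ofReal (z t k)) atTop (𝓝 (Z k)) →
      (∀ e, Tendsto (fun t => ENNReal.ofReal (z t e)) (F : Filter ℝ) (𝓝 (Z e))) →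
      ∑ i with N.head i = N.src k, f.flow i (localize Z i) (.inl k) =
        f.outflow (.inl k) (localize Z (.inl k)) := by
    intro z Z ρ hz hZ hzk hzZ
    have h1 := (tendsto_finsetSum (Finset.univ.filter fun i => N.head i = N.src k) fun i hi =>
      tendsto_flow (f := f) hzZ (hdi hZ (Finset.mem_filter.1 hi).2) (.inl k)).sub
      (RoutingPolicy.tendsto_outflow (f := f) hzZ (hdk hZ))
    have h2 := ((hz.tendsto_velocity_zero hZ hzk).mono_left hF).congr fun t =>
      velocity_eq_sum_filter f (z t) k
    exact sub_eq_zero.1 (tendsto_nhds_unique h1 h2)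
  have hYk' : Y k ≠ ∞ := hYk ▸ hk
  have h1 := hlimit h.sol hk (h.lim k) fun e => (h.lim e).mono_left hF
  have h2 := hlimit hy hYk' (hYk ▸ hlim) hY
  have hle : ∀ i ∈ Finset.univ.filter (fun i => N.head i = N.src k),
      f.flow i (localize X i) (.inl k) ≤ f.flow i (localize Y i) (.inl k) := fun i hi =>
    flow_mono hf hXY (hdi hYk' (Finset.mem_filter.1 hi).2) fun l hl => by
      rw [Sum.inl_injective hl, hYk]
  -- From `X` to `Y` the inflows of `k` can only rise and its outflow only fall, so balance in both
  -- states forces equality of every inflow.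
  have h4 := (Finset.sum_eq_sum_iff_of_le hle).1
    (le_antisymm (Finset.sum_le_sum hle)
      (by rw [h1, h2]; exact outflow_anti hf hXY (hdk hYk') hYk.symm))
  by_contra hne
  have hlt := (hXY e).lt_of_ne hne
  -- A larger density at `e` would strictly raise the flow from `i` to `k`; this uses that no link
  -- is empty in the limit and that `X k` is finite.
  have hstrict : ∀ i : N.InLink, N.head i = N.src k → (N.src e = N.head i ∨ Sum.inl e = i) →
      False := by
    intro i hi hei
    refine (flow_lt hf hXY (hdi hYk' hi) (j := .inl k) (fun l hl => ?_) hi.symm hei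
      (fun h => hke (Sum.inl_injective h)) hlt fun l _ _ => h.ne_zero hf hN l).ne
      (h4 i (by simpa using hi))
    rw [Sum.inl_injective hl]
    exact ⟨hYk.symm, hk⟩
  rcases he with he | he
  · obtain ⟨i, hi⟩ := hN.exists_head_eq (N.src k)
    exact hstrict i hi (.inl (he.trans hi.symm))
  · exact hstrict (.inl e) he (.inr rfl)

/-- Every trajectory converges to the minimal limit. -/
theorem tendsto_of_isSolution (h : f.IsMinimalLimit x X) (hf : f.IsStronglyMonotone)
    (hN : N.IsConnected) (hy : f.IsSolution ∞ ρ₀ y) (h0 : 0 ≤ ρ₀) (e : E) :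
    Tendsto (fun t => ENNReal.ofReal (y t e)) atTop (𝓝 (X e)) := by
  classical
  by_cases he : X e = ∞
  · rw [he]
    exact tendsto_nhds_top_mono (he ▸ h.lim e) (h.ofReal_le hf hy h0 e)
  -- The nodes where convergence fails. `exists_link` yields a link `k` from `B` to an unsaturated
  -- node outside it; `k` converges thanks to its head, and so do all links sharing its tail, a
  -- contradiction.
  set B : Finset V := Finset.univ.filter fun v => v ∉ saturatedSet N X ∧ ¬ N.IsDestination v ∧
    ¬ ∀ e, N.src e = v → Tendsto (fun t => ENNReal.ofReal (y t e)) atTop (𝓝 (X e)) with hB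
  have hBmem : ∀ {v}, v ∈ B ↔ v ∉ saturatedSet N X ∧ ¬ N.IsDestination v ∧
    ¬ ∀ e, N.src e = v → Tendsto (fun t => ENNReal.ofReal (y t e)) atTop (𝓝 (X e)) := by
    simp [hB]
  by_contra hcon
  have hs : N.src e ∉ saturatedSet N X := fun hs => he ((mem_saturatedSet.1 hs).2 e rfl)
  obtain ⟨k, hks, hkt, hkt'⟩ := h.exists_link hf hN (B := B) (fun v hv => (hBmem.1 hv).2.1)
    (fun v hv => (hBmem.1 hv).1)
    ⟨N.src e, hBmem.2 ⟨hs, not_isDestination_src e, fun hall => hcon (hall e rfl)⟩⟩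
  have hkX : X k ≠ ∞ := h.ne_top hf (hBmem.1 hks).1 hkt'
  have hk : Tendsto (fun t => ENNReal.ofReal (y t k)) atTop (𝓝 (X k)) := by
    rcases isDestination_or_exists_of_notMem_saturatedSet hkt' with hd | ⟨l, hl, hlX⟩
    · exact h.tendsto_of_isDestination hf hy h0 hd
    · have hl' : Tendsto (fun t => ENNReal.ofReal (y t l)) atTop (𝓝 (X l)) := by
        by_contra hl'
        exact hkt (hBmem.2 ⟨hkt', hl ▸ not_isDestination_src l, fun hall => hl' (hall l hl)⟩)
      exact h.tendsto_of_tendsto hf hN hy h0 hlX hl' (.inr hl.symm)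
  exact (hBmem.1 hks).2.2 fun e' he' => h.tendsto_of_tendsto hf hN hy h0 hkX hk (.inl he')

/-- The links that leave the saturated set fill up at the rate of its excess. -/
theorem tendsto_average (h : f.IsMinimalLimit x X) (hf : f.IsStronglyMonotone)
    (hy : f.IsSolution ∞ ρ₀ y) (h0 : 0 ≤ ρ₀) :
    Tendsto (fun t : ℝ => 1 / t * ∑ e ∈ N.linksFrom (saturatedSet N X), y t e) atTop
      (𝓝 (N.excess (saturatedSet N X))) := by
  set W := saturatedSet N X with hW
  have h1 : Tendsto (fun t => ∑ e ∈ N.linksFrom W, f.velocity (x t) e) atTop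
      (𝓝 (N.excess W)) := by
    have h2 := ((tendsto_const_nhds (x := ∑ v ∈ W, N.inflow v)).add
      (tendsto_finsetSum (N.inBoundary W) fun e he =>
        h.tendsto_outflow hf (.inl (mem_inBoundary.1 he).1))).sub
      (tendsto_finsetSum (N.outBoundary W) fun e he =>
        h.tendsto_outflow hf (.inr (mem_outBoundary.1 he).2))
    rw [Finset.sum_eq_zero (s := N.inBoundary W) fun e he =>
        limitOutflow_eq_zero (mem_inBoundary.1 he).2, add_zero,
      Finset.sum_congr rfl fun e he =>
        limitOutflow_eq_cap (mem_outBoundary.1 he).1 (mem_outBoundary.1 he).2] at h2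
    exact h2.congr fun t => (sum_velocity_linksFrom f (x t) fun v hv =>
      (mem_saturatedSet.1 hv).1).symm
  have h3 := tendsto_div_of_tendsto_deriv (g := fun t => ∑ e ∈ N.linksFrom W, x t e)
    (fun t ht => HasDerivWithinAt.fun_sum fun e _ => h.sol.hasDerivWithinAt e t ht) h1
  -- The initial ℓ¹ distance bounds all later ones, so dividing by `t` makes the gap between the two
  -- trajectories vanish.
  set A := ∑ e, (y 0 e - x 0 e)
  have h4 : Tendsto (fun t : ℝ => 1 / t * ∑ e ∈ N.linksFrom W, x t e + 1 / t * A) atTop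
      (𝓝 (N.excess W + 0 * A)) := by
    refine h3.add (Tendsto.mul_const A ?_)
    exact tendsto_inv_atTop_zero.congr fun t => (one_div t).symm
  rw [zero_mul, add_zero] at h4
  refine tendsto_of_tendsto_of_tendsto_of_le_of_le' h3 h4 ?_ ?_
  · filter_upwards [eventually_ge_atTop 0] with t ht
    refine mul_le_mul_of_nonneg_left (Finset.sum_le_sum fun e _ => ?_) (by positivity)
    exact sub_nonneg.1 (h.sol.sub_nonneg_of_le hf hy h0 ht e)
  · filter_upwards [eventually_ge_atTop 0] with t ht
    rw [← mul_add]
    refine mul_le_mul_of_nonneg_left ?_ (by positivity)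
    rw [← sub_le_iff_le_add', ← Finset.sum_sub_distrib]
    exact (Finset.sum_le_univ_sum_of_nonneg fun e =>
      h.sol.sub_nonneg_of_le hf hy h0 ht e).trans
      (h.sol.sum_sub_antitoneOn hf hy h0 (Set.mem_Ici.2 le_rfl) ht ht)

end IsMinimalLimit

end RoutingPolicy

end FlowNetwork

end

theorem proposition2 {V E : Type*} [Fintype V] [Fintype E] (N : FlowNetwork V E)
    (hN : N.IsConnected) (f : N.RoutingPolicy) (hf : f.IsStronglyMonotone)
    (hmax : ∃ U, N.IsMaxCut U ∧ 0 ≤ N.excess U) :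
    ∃ ρlim : E → ℝ, (∀ e, 0 ≤ ρlim e) ∧
      ∀ ρ₀ : E → ℝ, (∀ e, 0 ≤ ρ₀ e) →
        f.existenceTime ρ₀ = ∞ ∧
        ∃ ρ : ℝ → E → ℝ,
          f.IsSolution ∞ ρ₀ ρ ∧
          (∀ T ρ', f.IsSolution T ρ₀ ρ' → ∀ t, 0 ≤ t → ENNReal.ofReal t < T → ρ' t = ρ t) ∧
          (∀ e ∈ N.linksFrom N.criticalSet, Tendsto (fun t => ρ t e) atTop atTop) ∧
          Tendsto (fun t : ℝ => 1 / t * ∑ e ∈ N.linksFrom N.criticalSet, ρ t e) atTop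
            (𝓝 (N.excess N.criticalSet)) ∧
          (∀ e, e ∉ N.linksFrom N.criticalSet → e ∉ N.inBoundary N.criticalSet →
            Tendsto (fun t => ρ t e) atTop (𝓝 (ρlim e))) := by
  obtain ⟨x, X, h⟩ := FlowNetwork.RoutingPolicy.exists_isMinimalLimit hf
  -- Where `X e = ∞` this takes the default value 0, which no convergence claim uses.
  refine ⟨fun e => (X e).toReal, fun e => ENNReal.toReal_nonneg, fun ρ₀ h0 => ?_⟩
  obtain ⟨ρ, hρ⟩ := FlowNetwork.RoutingPolicy.exists_isSolution hf (ρ₀ := ρ₀) h0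
  have hlim := h.tendsto_of_isSolution hf hN hρ h0
  rw [← h.saturatedSet_eq hf hN hmax]
  refine ⟨top_unique (le_sSup ⟨ρ, hρ⟩), ρ, hρ, fun T ρ' hρ' t ht htT => ?_, fun e he => ?_,
    h.tendsto_average hf hρ h0, fun e he he' => ?_⟩
  · exact le_antisymm (hρ'.le hf hρ le_rfl ht htT ENNReal.ofReal_lt_top)
      (hρ.le hf hρ' le_rfl ht ENNReal.ofReal_lt_top htT)
  · have h1 := hlim e
    rw [(FlowNetwork.RoutingPolicy.mem_saturatedSet.1
      (FlowNetwork.mem_linksFrom.1 he)).2 e rfl] at h1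
    exact ENNReal.tendsto_ofReal_nhds_top.1 h1
  · rw [FlowNetwork.mem_linksFrom] at he
    have hX : X e ≠ ∞ := h.ne_top hf he fun ht =>
      he' (FlowNetwork.mem_inBoundary.2 ⟨he, ht⟩)
    refine ((ENNReal.tendsto_toReal hX).comp (hlim e)).congr' ?_
    filter_upwards [eventually_ge_atTop 0] with t ht
    exact ENNReal.toReal_ofReal (hρ.apply_nonneg e ht)
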